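/- Let $L$ be a separable infinite-dimensional complex Hilbert space with a conjugation $f\mapsto\bar f$ (an antilinear involution with $(\bar f,\bar g)=(g,f)$; scalar products are linear in the second argument), and let $a(f)$, $a^\dagger(f)$, $f\in L$, be a Fock representation of the canonical commutation relations in a complex Hilbert space $\mathcal F$. That is: $a(f)$ and $a^\dagger(f)$ are operators depending linearly on $f$ that map a common dense subspace $D\subset\mathcal F$ into itself; on $D$, $[a(f),a(g)]=0=[a^\dagger(f),a^\dagger(g)]$ and $[a(f),a^\dagger(g)]=(\bar f,g)\,\mathrm{id}$; $(a(f)\Phi,\Psi)=(\Phi,a^\dagger(\bar f)\Psi)$ for $\Phi,\Psi\in D$; and there is a vacuum $\Omega\in D$, $\|\Omega\|=1$, with $a(f)\Omega=0$ for all $f$, such that the vectors $a^\dagger(f_n)\cdots a^\dagger(f_1)\Omega$, $n\ge 0$, span a dense subspace of $\mathcal F$. Let $\mathcal F^{(n)}$ be the closed span of the vectors $a^\dagger(f_n)\cdots a^\dagger(f_1)\Omega$, let $\Phi^{(n)}$ be the orthogonal projection of $\Phi\in\mathcal F$ onto $\mathcal F^{(n)}$, and for $\alpha\ge 0$ put $D_\alpha=\{\Phi\in\mathcal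 F:\sum_{n=0}^\infty (n+1)^{2\alpha}\|\Phi^{(n)}\|^2<\infty\}$. Denote the extensions of $a(f)$, $a^\dagger(f)$ to $D_{1/2}$ (the restrictions to $D_{1/2}$ of their closures) by the same symbols. Then $D_1$ is dense in $\mathcal F$. For every bounded operator $B$ on $L$, every complete orthonormal system $(e_j)_{j\ge 1}$ of $L$ and every $M$, the partial sum $$d\Gamma_M(B)=\sum_{j=1}^M a^\dagger(Be_j)\,a(\bar e_j)$$ is defined on $D_1$. As $M\to\infty$, the $d\Gamma_M(B)$ converge strongly on $D_1$, i.e. $d\Gamma_M(B)\Phi$ converges in $\mathcal F$ for every $\Phi\in D_1$, and the limit operator $d\Gamma(B):D_1\to\mathcal F$, which is linear, does not depend on the choice of the complete orthonormal system. With $N:=d\Gamma(\mathrm{id})$, $$\|d\Gamma(B)\Phi\|\le\|B\|\,\|N\Phi\|,\qquad \Phi\in D_1 .$$ Furthermore $d\Gamma(B)^*=d\Gamma(B^*)$ on $D_1$, i.e. the domain of the Hilbert space adjoint of $d\Gamma(B)$, taken with domain $D_1$, contains $D_1$, and on $D_1$ this adjoint coincides with $d\Gamma(B^*)$. -/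

import Mathlib

open Filter Topology
open scoped InnerProductSpace LinearPMap

noncomputable section

/-- A conjugation on a complex Hilbert space: an antilinear involution `f ↦ f̄` compatible with
the scalar product, `(f̄, ḡ) = (g, f)`. -/
structure Conjugation (L : Type*) [NormedAddCommGroup L] [InnerProductSpace ℂ L] where
  /-- the underlying antilinear map -/
  toMap : L →ₗ⋆[ℂ] L
  involutive : ∀ f, toMap (toMap f) = f
  inner_map : ∀ f g, ⟪toMap f, toMap g⟫_ℂ = ⟪g, f⟫_ℂ

/-- A Fock representation, in the Hilbert space `F`, of the canonical commutation relations over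
the Hilbert space `L` with conjugation `J`. The domain `D` is invariant under all `a f` and
`adag f` because these are maps from `D` to `D`. Scalar products are antilinear in the first
argument. -/
structure FockRepresentation {L : Type*} [NormedAddCommGroup L] [InnerProductSpace ℂ L]
    (J : Conjugation L) (F : Type*) [NormedAddCommGroup F] [InnerProductSpace ℂ F] where
  /-- the common domain of definition -/
  D : Submodule ℂ F
  dense_D : Dense (D : Set F)
  /-- the annihilation operators -/
  a : L →ₗ[ℂ] D →ₗ[ℂ] D
  /-- the creation operators -/
  adag : L →ₗ[ℂ] D →ₗ[ℂ] D
  a_comm : ∀ f g Φ, a f (a g Φ) - a g (a f Φ) = 0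
  adag_comm : ∀ f g Φ, adag f (adag g Φ) - adag g (adag f Φ) = 0
  a_adag_comm : ∀ f g Φ, a f (adag g Φ) - adag g (a f Φ) = ⟪J.toMap f, g⟫_ℂ • Φ
  unitarity : ∀ (f : L) (Φ Ψ : D),
    ⟪(a f Φ : F), (Ψ : F)⟫_ℂ = ⟪(Φ : F), (adag (J.toMap f) Ψ : F)⟫_ℂ
  /-- the vacuum -/
  Ω : D
  norm_Ω : ‖(Ω : F)‖ = 1
  a_Ω : ∀ f, a f Ω = 0
  cyclic : Dense (Submodule.span ℂ
    (Set.range fun l : List L => ((l.foldr (fun f Φ => adag f Φ) Ω : D) : F)) : Set F)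

/-- The composition `g ∘ f` of partially defined operators, on its natural domain
`{x ∈ dom f | f x ∈ dom g}`. -/
def LinearPMap.natComp {E : Type*} [AddCommGroup E] [Module ℂ E]
    (g f : E →ₗ.[ℂ] E) : E →ₗ.[ℂ] E :=
  g.comp (f.domRestrict ((g.domain.comap f.toFun).map f.domain.subtype)) (by
    rintro ⟨x, ⟨⟨y, hy, rfl⟩, hx⟩⟩
    exact hy)

namespace FockRepresentation

variable {L : Type*} [NormedAddCommGroup L] [InnerProductSpace ℂ L] {J : Conjugation L}
  {F : Type*} [NormedAddCommGroup F] [InnerProductSpace ℂ F]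

/-- The closed `n`-particle space: the closure of the span of all vectors
`a†(f_n) ⋯ a†(f_1) Ω`. -/
def particleSpace (R : FockRepresentation J F) (n : ℕ) : Submodule ℂ F :=
  (Submodule.span ℂ {Φ : F | ∃ l : List L, l.length = n ∧
    Φ = ((l.foldr (fun f Ψ => R.adag f Ψ) R.Ω : R.D) : F)}).topologicalClosure

/-- The `n`-particle component `Φ⁽ⁿ⁾` of a vector: its orthogonal projection onto the
`n`-particle space. -/
def component [CompleteSpace F] (R : FockRepresentation J F) (n : ℕ) : F →L[ℂ] F :=
  haveI : CompleteSpace (R.particleSpace n) :=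
    (Submodule.isClosed_topologicalClosure _).completeSpace_coe
  (R.particleSpace n).starProjection

/-- The space `D_α` of all `Φ` with `∑ₙ (n + 1)^(2α) ‖Φ⁽ⁿ⁾‖² < ∞`. -/
def domainPow [CompleteSpace F] (R : FockRepresentation J F) (α : ℝ) : Submodule ℂ F where
  carrier := {Φ | Summable fun n : ℕ => ((n : ℝ) + 1) ^ (2 * α) * ‖R.component n Φ‖ ^ 2}
  zero_mem' := by simp
  add_mem' := by
    intro x y hx hy
    refine Summable.of_nonneg_of_le (fun n => by positivity) (fun n => ?_)
      ((hx.add hy).mul_left 2)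
    have h : ‖R.component n (x + y)‖ ^ 2
        ≤ 2 * (‖R.component n x‖ ^ 2 + ‖R.component n y‖ ^ 2) := by
      rw [map_add]
      have := norm_add_le (R.component n x) (R.component n y)
      nlinarith [sq_nonneg (‖R.component n x‖ - ‖R.component n y‖),
        norm_nonneg (R.component n x + R.component n y)]
    have hw : (0 : ℝ) ≤ ((n : ℝ) + 1) ^ (2 * α) := by positivity
    nlinarith [mul_le_mul_of_nonneg_left h hw]
  smul_mem' := by
    intro c x hx
    refine (Summable.mul_left (‖c‖ ^ 2) hx).congr fun n => ?_
    rw [map_smul, norm_smul]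
    ring

/-- An operator `T` on the dense domain `D`, regarded as an operator in `F`. -/
def toPMap (R : FockRepresentation J F) (T : R.D →ₗ[ℂ] R.D) : F →ₗ.[ℂ] F :=
  ⟨R.D, R.D.subtype ∘ₗ T⟩

/-- The annihilation operator `a(f)` extended to `D_{1/2}`: the restriction to `D_{1/2}` of the
closure of `a(f)`. (Annihilation operators are closable by the unitarity condition; the extension
of `a(f)` by continuity in the norm of `D_{1/2}` is contained in the closure.) -/
def aExt [CompleteSpace F] (R : FockRepresentation J F) (f : L) : F →ₗ.[ℂ] F :=
  (R.toPMap (R.a f)).closure.domRestrict (R.domainPow (1 / 2))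

/-- The creation operator `a†(f)` extended to `D_{1/2}`, in the same way. -/
def adagExt [CompleteSpace F] (R : FockRepresentation J F) (f : L) : F →ₗ.[ℂ] F :=
  (R.toPMap (R.adag f)).closure.domRestrict (R.domainPow (1 / 2))

/-- The partial sum `dΓ_M(B) = ∑_{j ≤ M} a†(B e_j) a(ē_j)`, as a partially defined operator in `F`
on its natural domain. -/
def dGammaPartial [CompleteSpace F] (R : FockRepresentation J F) (e : HilbertBasis ℕ ℂ L)
    (B : L →L[ℂ] L) (M : ℕ) : F →ₗ.[ℂ] F :=
  ∑ j ∈ Finset.range M, (R.adagExt (B (e j))).natComp (R.aExt (J.toMap (e j)))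

end FockRepresentation

end

/-! On finite-particle vectors everything rests on the commutator of `dΓ_M(B)` with `a†(f)`, which
is `a†(f_M)` with `f_M = ∑_{j<M} (e_j, f) B e_j → B f` (`pairSum_adag`). Induction on the particle
number then gives convergence there, with a limit depending on `B` alone (`exists_tendsto_pairSum`);
for `B = id` the limit is multiplication by `n`.

Passing to the closed sectors and to `D_1` needs the bound `‖B‖ n` on the `n`-particle space,
uniform in `M` (`norm_pairSum_le`). Moving creators across the scalar product turns `(Ψ, dΓ_M(B) Φ)`
into a sum of products of annihilated vectors. Cauchy–Schwarz then leaves `∑ ‖a(ē_j) Φ‖² ≤ n ‖Φ‖²`,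
and the same sum with `B e_j` for `e_j` and `Ψ` for `Φ`, which costs `‖B‖²` by the Hilbert–Schmidt
ideal inequality for the antilinear map `f ↦ a(f̄) Ψ`.

`F` is the Hilbert sum of the sectors, so strong convergence on `D_1` follows by dominated
convergence over `n`. Since `N` acts as `n`, the sector bounds sum to `‖B‖ ‖N Φ‖`. The adjoint of a
partial sum is `∑ a†(e_j) a(h̄_j)` with `h_j = B e_j`; its one-particle limit is `B*`, so it
converges to `dΓ(B*)`. -/

/-! ### Commutation relations and bounds on algebraic n-particle vectors -/

namespace FockRepresentation

variable {L : Type*} [NormedAddCommGroup L] [InnerProductSpace ℂ L] {J : Conjugation L}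
  {F : Type*} [NormedAddCommGroup F] [InnerProductSpace ℂ F]

/-- The linear span, inside the common domain `D`, of the vectors `a†(f_n) ⋯ a†(f_1) Ω`. -/
def wordSpan (R : FockRepresentation J F) (n : ℕ) : Submodule ℂ R.D :=
  Submodule.span ℂ {Φ : R.D | ∃ l : List L, l.length = n ∧
    Φ = l.foldr (fun f Ψ => R.adag f Ψ) R.Ω}

theorem wordSpan_zero_induction (R : FockRepresentation J F) {p : R.D → Prop}
    (hΩ : p R.Ω) (hsmul : ∀ (c : ℂ) Φ, p Φ → p (c • Φ)) {Φ : R.D} (hΦ : Φ ∈ R.wordSpan 0) :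
    p Φ := by
  have : {Φ : R.D | ∃ l : List L, l.length = 0 ∧
      Φ = l.foldr (fun f Ψ => R.adag f Ψ) R.Ω} = {R.Ω} := by
    ext Φ
    simp
  rw [wordSpan, this, Submodule.mem_span_singleton] at hΦ
  obtain ⟨c, rfl⟩ := hΦ
  exact hsmul c _ hΩ

theorem adag_mem_wordSpan (R : FockRepresentation J F) (f : L) {n : ℕ} {Φ : R.D}
    (hΦ : Φ ∈ R.wordSpan n) : R.adag f Φ ∈ R.wordSpan (n + 1) := by
  induction hΦ using Submodule.span_induction with
  | mem x hx =>
    obtain ⟨l, hl, rfl⟩ := hx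
    exact Submodule.subset_span ⟨f :: l, by simp [hl], rfl⟩
  | zero => simp
  | add x y _ _ hx hy => rw [map_add]; exact add_mem hx hy
  | smul c x _ hx => rw [map_smul]; exact Submodule.smul_mem _ c hx

theorem wordSpan_succ_induction (R : FockRepresentation J F) {n : ℕ} {p : R.D → Prop}
    (hadag : ∀ f, ∀ Φ ∈ R.wordSpan n, p (R.adag f Φ)) (hzero : p 0)
    (hadd : ∀ Φ Ψ, p Φ → p Ψ → p (Φ + Ψ)) (hsmul : ∀ (c : ℂ) Φ, p Φ → p (c • Φ))
    {Φ : R.D} (hΦ : Φ ∈ R.wordSpan (n + 1)) : p Φ := by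
  induction hΦ using Submodule.span_induction with
  | mem x hx =>
    obtain ⟨l, hl, rfl⟩ := hx
    cases l with
    | nil => simp at hl
    | cons f l => exact hadag f _ (Submodule.subset_span ⟨l, by simpa using hl, rfl⟩)
  | zero => exact hzero
  | add x y _ _ hx hy => exact hadd _ _ hx hy
  | smul c x _ hx => exact hsmul c _ hx

theorem a_wordSpan_zero (R : FockRepresentation J F) (f : L) {Φ : R.D}
    (hΦ : Φ ∈ R.wordSpan 0) : R.a f Φ = 0 :=
  R.wordSpan_zero_induction (p := fun Φ => R.a f Φ = 0) (R.a_Ω f)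
    (fun c Φ h => by rw [map_smul, h, smul_zero]) hΦ

theorem a_adag (R : FockRepresentation J F) (f g : L) (Φ : R.D) :
    R.a f (R.adag g Φ) = R.adag g (R.a f Φ) + ⟪J.toMap f, g⟫_ℂ • Φ := by
  rw [← R.a_adag_comm f g Φ]
  abel

theorem a_mem_wordSpan (R : FockRepresentation J F) (f : L) {n : ℕ} {Φ : R.D}
    (hΦ : Φ ∈ R.wordSpan (n + 1)) : R.a f Φ ∈ R.wordSpan n := by
  induction n generalizing Φ with
  | zero =>
    refine R.wordSpan_succ_induction (p := fun Φ => R.a f Φ ∈ R.wordSpan 0) ?_ (by simp)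
      (fun Φ Ψ h h' => by rw [map_add]; exact add_mem h h')
      (fun c Φ h => by rw [map_smul]; exact Submodule.smul_mem _ c h) hΦ
    intro g Φ hΦ
    rw [a_adag, R.a_wordSpan_zero f hΦ, map_zero, zero_add]
    exact Submodule.smul_mem _ _ hΦ
  | succ n ih =>
    refine R.wordSpan_succ_induction (p := fun Φ => R.a f Φ ∈ R.wordSpan (n + 1)) ?_ (by simp)
      (fun Φ Ψ h h' => by rw [map_add]; exact add_mem h h')
      (fun c Φ h => by rw [map_smul]; exact Submodule.smul_mem _ c h) hΦ
    intro g Φ hΦ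
    rw [a_adag]
    exact add_mem (R.adag_mem_wordSpan g (ih hΦ)) (Submodule.smul_mem _ _ hΦ)

theorem inner_adag_left (R : FockRepresentation J F) (f : L) (Φ Ψ : R.D) :
    ⟪(R.adag f Φ : F), (Ψ : F)⟫_ℂ = ⟪(Φ : F), (R.a (J.toMap f) Ψ : F)⟫_ℂ := by
  rw [← inner_conj_symm, ← inner_conj_symm (Φ : F), R.unitarity, J.involutive]

/-- Creators move across the scalar product as annihilators, lowering both particle numbers until
one side is a multiple of the vacuum. -/
theorem inner_eq_zero_of_mem_wordSpan (R : FockRepresentation J F) {m n : ℕ} (hmn : m ≠ n)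
    {Φ Ψ : R.D} (hΦ : Φ ∈ R.wordSpan m) (hΨ : Ψ ∈ R.wordSpan n) : ⟪(Φ : F), (Ψ : F)⟫_ℂ = 0 := by
  induction m generalizing n Φ Ψ with
  | zero =>
    obtain ⟨n, rfl⟩ : ∃ k, n = k + 1 := ⟨n - 1, by omega⟩
    refine R.wordSpan_zero_induction (p := fun Φ => ⟪(Φ : F), (Ψ : F)⟫_ℂ = 0) ?_
      (fun c Φ h => by rw [Submodule.coe_smul, inner_smul_left, h, mul_zero]) hΦ
    refine R.wordSpan_succ_induction (p := fun Ψ => ⟪(R.Ω : F), (Ψ : F)⟫_ℂ = 0) ?_ (by simp)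
      (fun _ _ h h' => by rw [Submodule.coe_add, inner_add_right, h, h', add_zero])
      (fun c Φ h => by rw [Submodule.coe_smul, inner_smul_right, h, mul_zero]) hΨ
    intro f Ψ _
    rw [← inner_conj_symm, inner_adag_left, R.a_Ω]
    simp
  | succ m ih =>
    refine R.wordSpan_succ_induction (p := fun Φ => ⟪(Φ : F), (Ψ : F)⟫_ℂ = 0) ?_ (by simp)
      (fun _ _ h h' => by rw [Submodule.coe_add, inner_add_left, h, h', add_zero])
      (fun c Φ h => by rw [Submodule.coe_smul, inner_smul_left, h, mul_zero]) hΦ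
    intro f Φ hΦ
    rw [inner_adag_left]
    cases n with
    | zero => rw [R.a_wordSpan_zero _ hΨ]; simp
    | succ n => exact ih (by omega) hΦ (R.a_mem_wordSpan _ hΨ)

theorem _root_.Conjugation.norm_map (J : Conjugation L) (f : L) : ‖J.toMap f‖ = ‖f‖ := by
  have h := J.inner_map f f
  rw [inner_self_eq_norm_sq_to_K, inner_self_eq_norm_sq_to_K] at h
  have h' : ‖J.toMap f‖ ^ 2 = ‖f‖ ^ 2 := by exact_mod_cast h
  exact (pow_left_inj₀ (norm_nonneg _) (norm_nonneg _) two_ne_zero).1 h'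

theorem norm_adag_sq (R : FockRepresentation J F) (f : L) (Φ : R.D) :
    ‖(R.adag f Φ : F)‖ ^ 2 = ‖(R.a (J.toMap f) Φ : F)‖ ^ 2 + ‖f‖ ^ 2 * ‖(Φ : F)‖ ^ 2 := by
  have h : ⟪(R.adag f Φ : F), (R.adag f Φ : F)⟫_ℂ =
      ⟪(R.a (J.toMap f) Φ : F), (R.a (J.toMap f) Φ : F)⟫_ℂ + ⟪f, f⟫_ℂ * ⟪(Φ : F), (Φ : F)⟫_ℂ := by
    rw [inner_adag_left, a_adag, J.involutive, Submodule.coe_add, Submodule.coe_smul,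
      inner_add_right, inner_smul_right, R.unitarity (J.toMap f), J.involutive]
  simp only [inner_self_eq_norm_sq_to_K] at h
  exact_mod_cast h

theorem norm_adag_le (R : FockRepresentation J F) (f : L) {n : ℕ} {Φ : R.D}
    (hΦ : Φ ∈ R.wordSpan n) : ‖(R.adag f Φ : F)‖ ≤ √(n + 1) * ‖f‖ * ‖(Φ : F)‖ := by
  -- With `Ψ = a(f̄) Φ`, `‖Ψ‖² = (Φ, a†(f) Ψ) ≤ ‖Φ‖ ‖a†(f) Ψ‖`. The induction hypothesis at `Ψ`, one
  -- particle lower, bounds the last factor; one power of `‖Ψ‖²` is then cancelled.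
  have key : ‖(R.a (J.toMap f) Φ : F)‖ ^ 2 ≤ n * ‖f‖ ^ 2 * ‖(Φ : F)‖ ^ 2 := by
    induction n generalizing Φ with
    | zero => rw [R.a_wordSpan_zero _ hΦ]; simp
    | succ n ih =>
      have hm := R.a_mem_wordSpan (J.toMap f) hΦ
      set Ψ := R.a (J.toMap f) Φ with hΨ
      have h1 : ‖(R.adag f Ψ : F)‖ ^ 2 ≤ (n + 1) * ‖f‖ ^ 2 * ‖(Ψ : F)‖ ^ 2 := by
        rw [norm_adag_sq]
        linarith [ih hm]
      have h2 : ‖(Ψ : F)‖ ^ 2 ≤ ‖(Φ : F)‖ * ‖(R.adag f Ψ : F)‖ := by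
        have h3 : ⟪(Ψ : F), (Ψ : F)⟫_ℂ = ⟪(Φ : F), (R.adag f Ψ : F)⟫_ℂ := by
          conv_lhs => rw [hΨ, R.unitarity, J.involutive]
        rw [inner_self_eq_norm_sq_to_K] at h3
        calc ‖(Ψ : F)‖ ^ 2 = ‖((‖(Ψ : F)‖ : ℂ)) ^ 2‖ := by simp
          _ ≤ _ := by
            have := norm_inner_le_norm (𝕜 := ℂ) (Φ : F) (R.adag f Ψ : F)
            rw [← h3] at this
            exact this
      have h4 : (‖(Ψ : F)‖ ^ 2) ^ 2 ≤ ‖(Φ : F)‖ ^ 2 * ((n + 1) * ‖f‖ ^ 2 * ‖(Ψ : F)‖ ^ 2) :=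
        calc (‖(Ψ : F)‖ ^ 2) ^ 2 ≤ (‖(Φ : F)‖ * ‖(R.adag f Ψ : F)‖) ^ 2 := by gcongr
          _ = ‖(Φ : F)‖ ^ 2 * ‖(R.adag f Ψ : F)‖ ^ 2 := by ring
          _ ≤ _ := by gcongr
      rcases (sq_nonneg ‖(Ψ : F)‖).eq_or_lt with h0 | h0
      · rw [← h0]; positivity
      · push_cast
        refine le_of_mul_le_mul_right ?_ h0
        calc _ = (‖(Ψ : F)‖ ^ 2) ^ 2 := by ring
          _ ≤ _ := h4
          _ = _ := by ring
  refine abs_le_of_sq_le_sq' ?_ (by positivity) |>.2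
  rw [norm_adag_sq, mul_pow, mul_pow, Real.sq_sqrt (by positivity)]
  linarith

theorem norm_a_le (R : FockRepresentation J F) (f : L) {n : ℕ} {Φ : R.D}
    (hΦ : Φ ∈ R.wordSpan n) : ‖(R.a f Φ : F)‖ ≤ √n * ‖f‖ * ‖(Φ : F)‖ := by
  have h := R.norm_adag_le (J.toMap f) hΦ
  have h2 := R.norm_adag_sq (J.toMap f) Φ
  rw [J.norm_map] at h h2
  rw [J.involutive] at h2
  have h3 : ‖(R.adag (J.toMap f) Φ : F)‖ ^ 2 ≤ (√(n + 1) * ‖f‖ * ‖(Φ : F)‖) ^ 2 := by gcongr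
  rw [mul_pow, mul_pow, Real.sq_sqrt (by positivity)] at h3
  refine abs_le_of_sq_le_sq' ?_ (by positivity) |>.2
  rw [mul_pow, mul_pow, Real.sq_sqrt (by positivity)]
  linarith

/-- Both factors are `√n`: the creator acts after the annihilator has removed a particle. -/
theorem norm_adag_a_le (R : FockRepresentation J F) (f g : L) {n : ℕ} {Φ : R.D}
    (hΦ : Φ ∈ R.wordSpan n) :
    ‖((R.adag g ∘ₗ R.a f) Φ : F)‖ ≤ (√n * ‖g‖ * (√n * ‖f‖)) * ‖(Φ : F)‖ := by
  cases n with
  | zero => simp [R.a_wordSpan_zero f hΦ]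
  | succ n =>
    refine (R.norm_adag_le g (R.a_mem_wordSpan f hΦ)).trans ?_
    have := R.norm_a_le f hΦ
    push_cast at this ⊢
    rw [mul_assoc (√(n + 1) * ‖g‖)]
    gcongr

/-- The finite sum `∑_{j < M} a†(g_j) a(h̄_j)` on the common domain. -/
def pairSum (R : FockRepresentation J F) (g h : ℕ → L) (M : ℕ) : R.D →ₗ[ℂ] R.D :=
  ∑ j ∈ Finset.range M, R.adag (g j) ∘ₗ R.a (J.toMap (h j))

theorem pairSum_apply (R : FockRepresentation J F) (g h : ℕ → L) (M : ℕ) (Φ : R.D) :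
    R.pairSum g h M Φ = ∑ j ∈ Finset.range M, R.adag (g j) (R.a (J.toMap (h j)) Φ) := by
  simp [pairSum]

/-- Each summand contributes only the scalar commutator of its annihilator with `a†(f)`: second
quantization acts as a derivation. -/
theorem pairSum_adag (R : FockRepresentation J F) (g h : ℕ → L) (M : ℕ) (f : L) (Φ : R.D) :
    R.pairSum g h M (R.adag f Φ) = R.adag f (R.pairSum g h M Φ) +
      R.adag (∑ j ∈ Finset.range M, ⟪h j, f⟫_ℂ • g j) Φ := by
  simp only [pairSum_apply, a_adag, J.involutive, map_add, map_smul, map_sum,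
    Finset.sum_add_distrib, LinearMap.sum_apply, LinearMap.smul_apply]
  congr 1
  refine Finset.sum_congr rfl fun j _ => ?_
  rw [← sub_eq_zero, R.adag_comm]

theorem pairSum_wordSpan_zero (R : FockRepresentation J F) (g h : ℕ → L) (M : ℕ) {Φ : R.D}
    (hΦ : Φ ∈ R.wordSpan 0) : R.pairSum g h M Φ = 0 := by
  simp [pairSum_apply, R.a_wordSpan_zero _ hΦ]

theorem pairSum_mem_wordSpan (R : FockRepresentation J F) (g h : ℕ → L) (M : ℕ) {n : ℕ} {Φ : R.D}
    (hΦ : Φ ∈ R.wordSpan n) : R.pairSum g h M Φ ∈ R.wordSpan n := by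
  cases n with
  | zero => rw [R.pairSum_wordSpan_zero g h M hΦ]; exact zero_mem _
  | succ n =>
    rw [pairSum_apply]
    exact sum_mem fun j _ => R.adag_mem_wordSpan _ (R.a_mem_wordSpan _ hΦ)

theorem inner_pairSum (R : FockRepresentation J F) (g h : ℕ → L) (M : ℕ) (Φ Ψ : R.D) :
    ⟪(Ψ : F), (R.pairSum g h M Φ : F)⟫_ℂ = ∑ j ∈ Finset.range M,
      ⟪(R.a (J.toMap (g j)) Ψ : F), (R.a (J.toMap (h j)) Φ : F)⟫_ℂ := by
  rw [pairSum_apply, Submodule.coe_sum, inner_sum]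
  refine Finset.sum_congr rfl fun j _ => ?_
  rw [R.unitarity, J.involutive]

/-- Taking adjoints exchanges the two families, hence the need for sums with independent `g` and
`h`. -/
theorem inner_pairSum_swap (R : FockRepresentation J F) (g h : ℕ → L) (M : ℕ) (Φ Ψ : R.D) :
    ⟪(R.pairSum g h M Φ : F), (Ψ : F)⟫_ℂ = ⟪(Φ : F), (R.pairSum h g M Ψ : F)⟫_ℂ := by
  rw [← inner_conj_symm, inner_pairSum, inner_pairSum, map_sum]
  simp only [inner_conj_symm]

/-- Joint continuity holds because the particle number is fixed, so that one constant `√(n + 1)`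
bounds all the creators. -/
theorem tendsto_adag (R : FockRepresentation J F) {n : ℕ} {f : ℕ → L} {f₀ : L}
    {Φ : ℕ → R.D} {Φ₀ : R.D} (hf : Tendsto f atTop (𝓝 f₀))
    (hΦ : Tendsto (fun M => (Φ M : F)) atTop (𝓝 (Φ₀ : F)))
    (hmem : ∀ M, Φ M ∈ R.wordSpan n) (hmem₀ : Φ₀ ∈ R.wordSpan n) :
    Tendsto (fun M => (R.adag (f M) (Φ M) : F)) atTop (𝓝 (R.adag f₀ Φ₀ : F)) := by
  rw [tendsto_iff_norm_sub_tendsto_zero]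
  have h1 : Tendsto (fun M => √(n + 1) * ‖f M‖ * ‖(Φ M : F) - Φ₀‖ +
      √(n + 1) * ‖f M - f₀‖ * ‖(Φ₀ : F)‖) atTop (𝓝 0) := by
    have := ((hf.norm.const_mul √(n + 1)).mul (tendsto_iff_norm_sub_tendsto_zero.1 hΦ)).add
      (((tendsto_iff_norm_sub_tendsto_zero.1 hf).const_mul √(n + 1)).mul_const ‖(Φ₀ : F)‖)
    simpa using this
  refine squeeze_zero (fun _ => norm_nonneg _) (fun M => ?_) h1
  have h2 : (R.adag (f M) (Φ M) : F) - R.adag f₀ Φ₀ =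
      (R.adag (f M) (Φ M - Φ₀) : F) + (R.adag (f M - f₀) Φ₀ : F) := by
    simp only [map_sub, LinearMap.sub_apply, Submodule.coe_sub]
    abel
  rw [h2]
  refine (norm_add_le _ _).trans (add_le_add ?_ (R.norm_adag_le _ hmem₀))
  exact R.norm_adag_le (f M) (sub_mem (hmem M) hmem₀)

/-- On algebraic `n`-particle vectors the sums `∑_j a†(g_j) a(h̄_j)` converge as soon as the
one-particle operators `∑_j (h_j, ·) g_j` do, and the limit depends on the limit operator only. -/
theorem exists_tendsto_pairSum (R : FockRepresentation J F) (B : L → L) {n : ℕ} {Φ : R.D}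
    (hΦ : Φ ∈ R.wordSpan n) : ∃ Ψ ∈ R.wordSpan n, ∀ g h : ℕ → L,
      (∀ f, Tendsto (fun M => ∑ j ∈ Finset.range M, ⟪h j, f⟫_ℂ • g j) atTop (𝓝 (B f))) →
      Tendsto (fun M => (R.pairSum g h M Φ : F)) atTop (𝓝 (Ψ : F)) := by
  induction n generalizing Φ with
  | zero =>
    refine ⟨0, zero_mem _, fun g h _ => ?_⟩
    simp [R.pairSum_wordSpan_zero g h _ hΦ]
  | succ n ih =>
    refine R.wordSpan_succ_induction (p := fun Φ => ∃ Ψ ∈ R.wordSpan (n + 1), ∀ g h : ℕ → L,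
      (∀ f, Tendsto (fun M => ∑ j ∈ Finset.range M, ⟪h j, f⟫_ℂ • g j) atTop (𝓝 (B f))) →
      Tendsto (fun M => (R.pairSum g h M Φ : F)) atTop (𝓝 (Ψ : F))) ?_ ?_ ?_ ?_ hΦ
    · intro f Φ hΦ
      obtain ⟨Ψ, hΨ, H⟩ := ih hΦ
      -- The termwise limit of the commutator formula `pairSum_adag`.
      refine ⟨R.adag f Ψ + R.adag (B f) Φ,
        add_mem (R.adag_mem_wordSpan _ hΨ) (R.adag_mem_wordSpan _ hΦ), fun g h hgh => ?_⟩
      simp only [pairSum_adag, Submodule.coe_add]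
      exact (R.tendsto_adag tendsto_const_nhds (H g h hgh)
        (fun M => R.pairSum_mem_wordSpan g h M hΦ) hΨ).add
        (R.tendsto_adag (hgh f) tendsto_const_nhds (fun _ => hΦ) hΦ)
    · exact ⟨0, zero_mem _, fun g h _ => by simp⟩
    · rintro Φ Φ' ⟨Ψ, hΨ, H⟩ ⟨Ψ', hΨ', H'⟩
      refine ⟨Ψ + Ψ', add_mem hΨ hΨ', fun g h hgh => ?_⟩
      simp only [map_add, Submodule.coe_add]
      exact (H g h hgh).add (H' g h hgh)
    · rintro c Φ ⟨Ψ, hΨ, H⟩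
      refine ⟨c • Ψ, Submodule.smul_mem _ c hΨ, fun g h hgh => ?_⟩
      simp only [map_smul, Submodule.coe_smul]
      exact (H g h hgh).const_smul c

/-- Each creator in a word contributes the word itself once through the commutator, so the limit
counts particles. -/
theorem tendsto_pairSum_of_tendsto_id (R : FockRepresentation J F) {g h : ℕ → L}
    (hgh : ∀ f, Tendsto (fun M => ∑ j ∈ Finset.range M, ⟪h j, f⟫_ℂ • g j) atTop (𝓝 f))
    {n : ℕ} {Φ : R.D} (hΦ : Φ ∈ R.wordSpan n) :
    Tendsto (fun M => (R.pairSum g h M Φ : F)) atTop (𝓝 ((n : ℂ) • (Φ : F))) := by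
  induction n generalizing Φ with
  | zero => simp [R.pairSum_wordSpan_zero g h _ hΦ]
  | succ n ih =>
    refine R.wordSpan_succ_induction (p := fun Φ => Tendsto (fun M => (R.pairSum g h M Φ : F))
      atTop (𝓝 (((n + 1 : ℕ) : ℂ) • (Φ : F)))) ?_ (by simp) ?_ ?_ hΦ
    · intro f Φ hΦ
      simp only [pairSum_adag, Submodule.coe_add]
      have := (R.tendsto_adag (Φ₀ := (n : ℂ) • Φ) (tendsto_const_nhds (x := f)) (ih hΦ)
        (fun M => R.pairSum_mem_wordSpan g h M hΦ) (Submodule.smul_mem _ _ hΦ)).add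
        (R.tendsto_adag (hgh f) tendsto_const_nhds (fun _ => hΦ) hΦ)
      convert this using 2
      simp [add_smul]
    · intro Φ Ψ h1 h2
      simp only [map_add, Submodule.coe_add, smul_add]
      exact h1.add h2
    · intro c Φ h1
      simp only [map_smul, Submodule.coe_smul]
      rw [smul_comm]
      exact h1.const_smul c

end FockRepresentation

/-! ### Hilbert bases and the Hilbert–Schmidt ideal inequality -/

theorem HilbertBasis.hasSum_norm_inner_sq {ι E : Type*} [NormedAddCommGroup E]
    [InnerProductSpace ℂ E] (b : HilbertBasis ι ℂ E) (x : E) :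
    HasSum (fun i => ‖⟪b i, x⟫_ℂ‖ ^ 2) (‖x‖ ^ 2) := by
  have h := b.hasSum_inner_mul_inner x x
  rw [inner_self_eq_norm_sq_to_K] at h
  have h2 : (fun i => ⟪x, b i⟫_ℂ * ⟪b i, x⟫_ℂ) = fun i => ((‖⟪b i, x⟫_ℂ‖ ^ 2 : ℝ) : ℂ) := by
    funext i
    rw [← inner_conj_symm x, Complex.conj_mul']
    push_cast
    rfl
  rw [h2] at h
  exact Complex.hasSum_ofReal.1 (by simpa using h)

/-- The Hilbert–Schmidt ideal inequality `‖S B‖₂ ≤ ‖B‖ ‖S‖₂`, for an antilinear operator `S`. -/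
theorem sum_norm_sq_comp_le {ι L F : Type*} [NormedAddCommGroup L] [InnerProductSpace ℂ L]
    [CompleteSpace L] [NormedAddCommGroup F] [InnerProductSpace ℂ F] [CompleteSpace F]
    (S : L →L⋆[ℂ] F) (B : L →L[ℂ] L) (e : HilbertBasis ι ℂ L) {C : ℝ}
    (hC : ∀ s : Finset ι, ∑ j ∈ s, ‖S (e j)‖ ^ 2 ≤ C) (s : Finset ι) :
    ∑ j ∈ s, ‖S (B (e j))‖ ^ 2 ≤ ‖B‖ ^ 2 * C := by
  obtain ⟨w, b, -⟩ := exists_hilbertBasis ℂ F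
  -- `v i` is the antilinear adjoint of `S` applied to `b i`, obtained from Riesz: `f ↦ (S f, b i)`
  -- is linear because `S` is antilinear.
  have hw : ∀ i, ∃ v : L, ∀ f, ⟪v, f⟫_ℂ = ⟪S f, b i⟫_ℂ := by
    intro i
    let φ : L →L[ℂ] ℂ := LinearMap.mkContinuous
      { toFun := fun f => ⟪S f, b i⟫_ℂ
        map_add' := fun f g => by rw [map_add, inner_add_left]
        map_smul' := fun c f => by
          rw [map_smulₛₗ, inner_smul_left]
          simp } (‖S‖ * ‖b i‖) (fun f => by
        calc ‖⟪S f, b i⟫_ℂ‖ ≤ ‖S f‖ * ‖b i‖ := norm_inner_le_norm _ _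
          _ ≤ (‖S‖ * ‖f‖) * ‖b i‖ := by gcongr; exact S.le_opNorm f
          _ = _ := by ring)
    exact ⟨(InnerProductSpace.toDual ℂ L).symm φ, fun f => by
      rw [InnerProductSpace.toDual_symm_apply]; rfl⟩
  choose v hv using hw
  have hnorm : ∀ i f, ‖⟪f, v i⟫_ℂ‖ = ‖⟪b i, S f⟫_ℂ‖ := fun i f => by
    rw [norm_inner_symm, hv, norm_inner_symm]
  -- The adjoint has the same Hilbert–Schmidt bound: Parseval in `e`, then Bessel in `b`.
  have hA : ∀ t : Finset w, ∑ i ∈ t, ‖v i‖ ^ 2 ≤ C := by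
    intro t
    refine hasSum_le_of_sum_le
      (hasSum_sum fun i (_ : i ∈ t) => e.hasSum_norm_inner_sq (v i)) fun r => ?_
    refine le_trans (Finset.sum_le_sum fun j _ => ?_) (hC r)
    simp only [hnorm]
    exact b.orthonormal.sum_inner_products_le _
  refine hasSum_le_of_sum_le
    (hasSum_sum fun j (_ : j ∈ s) => b.hasSum_norm_inner_sq (S (B (e j)))) fun t => ?_
  calc ∑ i ∈ t, ∑ j ∈ s, ‖⟪b i, S (B (e j))⟫_ℂ‖ ^ 2
      ≤ ∑ i ∈ t, ‖B‖ ^ 2 * ‖v i‖ ^ 2 := by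
        refine Finset.sum_le_sum fun i _ => ?_
        -- `B` now acts on the other side, as `B*` on `v i`, where Bessel in `e` and `‖B*‖ = ‖B‖`
        -- apply.
        have h1 : ∀ j, ‖⟪b i, S (B (e j))⟫_ℂ‖ =
            ‖⟪e j, ContinuousLinearMap.adjoint B (v i)⟫_ℂ‖ := fun j => by
          rw [← hnorm, ContinuousLinearMap.adjoint_inner_right]
        simp only [h1]
        refine (e.orthonormal.sum_inner_products_le _).trans ?_
        rw [← mul_pow]
        gcongr
        refine (ContinuousLinearMap.le_opNorm _ _).trans_eq ?_
        rw [LinearIsometryEquiv.norm_map]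
    _ ≤ ‖B‖ ^ 2 * C := by
        rw [← Finset.mul_sum]
        gcongr
        exact hA t

/-- A separable infinite-dimensional Hilbert space has an orthonormal basis indexed by `ℕ`. -/
theorem exists_hilbertBasis_nat (L : Type*) [NormedAddCommGroup L] [InnerProductSpace ℂ L]
    [CompleteSpace L] [TopologicalSpace.SeparableSpace L] (hL : ¬ FiniteDimensional ℂ L) :
    Nonempty (HilbertBasis ℕ ℂ L) := by
  obtain ⟨w, b, -⟩ := exists_hilbertBasis ℂ L
  have hb : Orthonormal ℂ b := b.orthonormal
  -- Distinct basis vectors are `√2 ≥ 1` apart, so the balls of radius `1/2` are disjoint and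
  -- separability makes the index set countable.
  have hdist : Pairwise fun i j => (1 / 2 : ℝ) + 1 / 2 ≤ dist (b i) (b j) := by
    intro i j hij
    have h : ‖b i - b j‖ ^ 2 = 2 := by
      rw [@norm_sub_sq ℂ, hb.1 i, hb.1 j, hb.2 hij]
      norm_num
    rw [dist_eq_norm]
    nlinarith [norm_nonneg (b i - b j)]
  have hcount : Countable w := by
    refine Pairwise.countable_of_isOpen_disjoint (s := fun i => Metric.ball (b i) (1 / 2))
      (fun i j hij => Metric.ball_disjoint_ball (hdist hij)) (fun _ => Metric.isOpen_ball)
      (fun i => ⟨b i, Metric.mem_ball_self (by norm_num)⟩)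
  have hinf : Infinite w := by
    by_contra hfin
    rw [not_infinite_iff_finite] at hfin
    have := Fintype.ofFinite w
    exact hL b.toOrthonormalBasis.toBasis.finiteDimensional_of_finite
  obtain ⟨φ⟩ : Nonempty (w ≃ ℕ) := nonempty_equiv_of_countable
  refine ⟨HilbertBasis.mk (v := b ∘ φ.symm) (hb.comp _ φ.symm.injective) ?_⟩
  rw [Set.range_comp, φ.symm.surjective.range_eq, Set.image_univ, b.dense_span]

theorem HilbertBasis.tendsto_sum_inner_smul {L : Type*} [NormedAddCommGroup L]
    [InnerProductSpace ℂ L] (e : HilbertBasis ℕ ℂ L) (B : L →L[ℂ] L) (f : L) :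
    Tendsto (fun M => ∑ j ∈ Finset.range M, ⟪e j, f⟫_ℂ • B (e j)) atTop (𝓝 (B f)) := by
  have h := ((e.hasSum_repr f).mapL B).tendsto_sum_nat
  simpa only [map_smul, e.repr_apply_apply] using h

theorem HilbertBasis.tendsto_sum_inner_map_smul {L : Type*} [NormedAddCommGroup L]
    [InnerProductSpace ℂ L] [CompleteSpace L] (e : HilbertBasis ℕ ℂ L) (B : L →L[ℂ] L) (f : L) :
    Tendsto (fun M => ∑ j ∈ Finset.range M, ⟪B (e j), f⟫_ℂ • e j)
      atTop (𝓝 (ContinuousLinearMap.adjoint B f)) := by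
  simp only [← ContinuousLinearMap.adjoint_inner_right B]
  exact e.tendsto_sum_inner_smul (ContinuousLinearMap.id ℂ L) (ContinuousLinearMap.adjoint B f)

/-! ### The bound on partial sums, uniform in M -/

namespace FockRepresentation

variable {L : Type*} [NormedAddCommGroup L] [InnerProductSpace ℂ L] {J : Conjugation L}
  {F : Type*} [NormedAddCommGroup F] [InnerProductSpace ℂ F]

/-- The sums over initial segments are the expectations of the partial number operators in `Ψ`,
which increase to `n ‖Ψ‖²`. -/
theorem sum_norm_a_sq_le (R : FockRepresentation J F) (e : HilbertBasis ℕ ℂ L)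
    {n : ℕ} {Ψ : R.D} (hΨ : Ψ ∈ R.wordSpan n) (s : Finset ℕ) :
    ∑ j ∈ s, ‖(R.a (J.toMap (e j)) Ψ : F)‖ ^ 2 ≤ n * ‖(Ψ : F)‖ ^ 2 := by
  have h1 : Tendsto (fun M => ∑ j ∈ Finset.range M, ‖(R.a (J.toMap (e j)) Ψ : F)‖ ^ 2) atTop
      (𝓝 (n * ‖(Ψ : F)‖ ^ 2)) := by
    have h2 := R.tendsto_pairSum_of_tendsto_id
      (e.tendsto_sum_inner_smul (ContinuousLinearMap.id ℂ L)) hΨ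
    have h3 := (Complex.continuous_re.tendsto _).comp
      ((tendsto_const_nhds (x := (Ψ : F))).inner (𝕜 := ℂ) h2)
    convert h3 using 1
    · funext M
      simp only [Function.comp, ContinuousLinearMap.id_apply, inner_pairSum, Complex.re_sum]
      exact Finset.sum_congr rfl fun j _ => (inner_self_eq_norm_sq (𝕜 := ℂ) _).symm
    · rw [inner_smul_right, ← inner_self_eq_norm_sq (𝕜 := ℂ)]
      simp [Complex.mul_re]
  obtain ⟨M, hM⟩ := s.exists_nat_subset_range
  refine (Finset.sum_le_sum_of_subset_of_nonneg hM fun _ _ _ => sq_nonneg _).trans ?_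
  refine Monotone.ge_of_tendsto (f := fun M =>
    ∑ j ∈ Finset.range M, ‖(R.a (J.toMap (e j)) Ψ : F)‖ ^ 2) ?_ h1 M
  exact fun a b hab => Finset.sum_le_sum_of_subset_of_nonneg (Finset.range_mono hab)
    fun _ _ _ => sq_nonneg _

variable [CompleteSpace L] [CompleteSpace F]

theorem sum_norm_a_map_sq_le (R : FockRepresentation J F) (e : HilbertBasis ℕ ℂ L)
    (B : L →L[ℂ] L) {n : ℕ} {Ψ : R.D} (hΨ : Ψ ∈ R.wordSpan n) (s : Finset ℕ) :
    ∑ j ∈ s, ‖(R.a (J.toMap (B (e j))) Ψ : F)‖ ^ 2 ≤ ‖B‖ ^ 2 * (n * ‖(Ψ : F)‖ ^ 2) := by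
  let S : L →L⋆[ℂ] F := LinearMap.mkContinuous
    { toFun := fun f => (R.a (J.toMap f) Ψ : F)
      map_add' := fun f g => by simp
      map_smul' := fun c f => by simp [map_smulₛₗ] } (√n * ‖(Ψ : F)‖) (fun f => by
        have := R.norm_a_le (J.toMap f) hΨ
        rw [J.norm_map] at this
        calc _ ≤ _ := this
          _ = _ := by ring)
  exact sum_norm_sq_comp_le S B e (fun s => R.sum_norm_a_sq_le e hΨ s) s

/-- The vector is paired with itself: `‖Ψ‖²` expands into scalar products of annihilated vectors,
Cauchy–Schwarz gives `‖Ψ‖⁴ ≤ (‖B‖ n ‖Φ‖)² ‖Ψ‖²`, and `‖Ψ‖²` cancels. -/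
theorem norm_pairSum_le (R : FockRepresentation J F) (e : HilbertBasis ℕ ℂ L)
    (B : L →L[ℂ] L) (M : ℕ) {n : ℕ} {Φ : R.D} (hΦ : Φ ∈ R.wordSpan n) :
    ‖(R.pairSum (fun j => B (e j)) e M Φ : F)‖ ≤ ‖B‖ * n * ‖(Φ : F)‖ := by
  set Ψ := R.pairSum (fun j => B (e j)) e M Φ with hΨ
  have hmem : Ψ ∈ R.wordSpan n := R.pairSum_mem_wordSpan _ _ M hΦ
  have h1 : ‖(Ψ : F)‖ ^ 2 ≤ ∑ j ∈ Finset.range M,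
      ‖(R.a (J.toMap (B (e j))) Ψ : F)‖ * ‖(R.a (J.toMap (e j)) Φ : F)‖ := by
    have h2 : ⟪(Ψ : F), (Ψ : F)⟫_ℂ = ∑ j ∈ Finset.range M,
        ⟪(R.a (J.toMap (B (e j))) Ψ : F), (R.a (J.toMap (e j)) Φ : F)⟫_ℂ := by
      conv_lhs => rw [hΨ, inner_pairSum]
    calc ‖(Ψ : F)‖ ^ 2 = ‖⟪(Ψ : F), (Ψ : F)⟫_ℂ‖ := by
          rw [inner_self_eq_norm_sq_to_K]; simp
      _ ≤ _ := by
          rw [h2]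
          exact (norm_sum_le _ _).trans (Finset.sum_le_sum fun j _ => norm_inner_le_norm _ _)
  have h3 : (‖(Ψ : F)‖ ^ 2) ^ 2 ≤ (‖B‖ ^ 2 * (n * ‖(Ψ : F)‖ ^ 2)) * (n * ‖(Φ : F)‖ ^ 2) :=
    calc (‖(Ψ : F)‖ ^ 2) ^ 2 ≤ _ := pow_le_pow_left₀ (sq_nonneg _) h1 2
      _ ≤ _ := Finset.sum_mul_sq_le_sq_mul_sq _ _ _
      _ ≤ _ := mul_le_mul (R.sum_norm_a_map_sq_le e B hmem _) (R.sum_norm_a_sq_le e hΦ _)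
        (Finset.sum_nonneg fun _ _ => sq_nonneg _) (by positivity)
  rcases (norm_nonneg (Ψ : F)).eq_or_lt with h0 | h0
  · rw [← h0]; positivity
  · refine abs_le_of_sq_le_sq' ?_ (by positivity) |>.2
    refine le_of_mul_le_mul_right ?_ (pow_pos h0 2)
    calc _ = (‖(Ψ : F)‖ ^ 2) ^ 2 := by ring
      _ ≤ _ := h3
      _ = _ := by ring

end FockRepresentation

/-! ### Closed n-particle spaces and extension of operators to them -/

namespace FockRepresentation

variable {L : Type*} [NormedAddCommGroup L] [InnerProductSpace ℂ L] {J : Conjugation L}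
  {F : Type*} [NormedAddCommGroup F] [InnerProductSpace ℂ F]

theorem particleSpace_eq_topologicalClosure (R : FockRepresentation J F) (n : ℕ) :
    R.particleSpace n = ((R.wordSpan n).map R.D.subtype).topologicalClosure := by
  rw [particleSpace, wordSpan, Submodule.map_span]
  congr 2
  ext Φ
  simp only [Set.mem_ofPred_eq, Set.mem_image, Submodule.coe_subtype]
  constructor
  · rintro ⟨l, hl, rfl⟩
    exact ⟨_, ⟨l, hl, rfl⟩, rfl⟩
  · rintro ⟨_, ⟨l, hl, rfl⟩, rfl⟩
    exact ⟨l, hl, rfl⟩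

theorem isClosed_particleSpace (R : FockRepresentation J F) (n : ℕ) :
    IsClosed (R.particleSpace n : Set F) :=
  Submodule.isClosed_topologicalClosure _

theorem coe_mem_particleSpace (R : FockRepresentation J F) {n : ℕ} {Φ : R.D}
    (hΦ : Φ ∈ R.wordSpan n) : (Φ : F) ∈ R.particleSpace n := by
  rw [particleSpace_eq_topologicalClosure]
  exact Submodule.le_topologicalClosure _ (Submodule.mem_map_of_mem (f := R.D.subtype) hΦ)

theorem particleSpace_induction (R : FockRepresentation J F) {n : ℕ} {p : F → Prop}
    (hp : IsClosed {x | p x}) (h : ∀ Φ ∈ R.wordSpan n, p (Φ : F)) {x : F}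
    (hx : x ∈ R.particleSpace n) : p x := by
  rw [particleSpace_eq_topologicalClosure] at hx
  refine closure_minimal ?_ hp hx
  rintro _ ⟨Φ, hΦ, rfl⟩
  exact h Φ hΦ

theorem inner_eq_zero_of_mem_particleSpace (R : FockRepresentation J F) {m n : ℕ} (hmn : m ≠ n)
    {x y : F} (hx : x ∈ R.particleSpace m) (hy : y ∈ R.particleSpace n) : ⟪x, y⟫_ℂ = 0 := by
  refine R.particleSpace_induction (p := fun x => ⟪x, y⟫_ℂ = 0)
    (isClosed_eq (by fun_prop) continuous_const) (fun Φ hΦ => ?_) hx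
  refine R.particleSpace_induction (p := fun y => ⟪(Φ : F), y⟫_ℂ = 0)
    (isClosed_eq (by fun_prop) continuous_const) (fun Ψ hΨ => ?_) hy
  exact R.inner_eq_zero_of_mem_wordSpan hmn hΦ hΨ

theorem orthogonalFamily_particleSpace (R : FockRepresentation J F) :
    OrthogonalFamily ℂ (fun n => R.particleSpace n) fun n => (R.particleSpace n).subtypeₗᵢ :=
  fun _ _ hmn x y => R.inner_eq_zero_of_mem_particleSpace hmn x.2 y.2

theorem hasSum_norm_sq (R : FockRepresentation J F) {x : ℕ → F} {y : F}
    (hx : ∀ n, x n ∈ R.particleSpace n) (hy : HasSum x y) :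
    HasSum (fun n => ‖x n‖ ^ 2) (‖y‖ ^ 2) := by
  have h := (hy.norm.pow 2 : Tendsto _ _ _)
  refine h.congr fun s => ?_
  exact R.orthogonalFamily_particleSpace.norm_sum (fun n => ⟨x n, hx n⟩) s

/-- The inclusion of the algebraic into the closed `n`-particle space. -/
def wordInclusion (R : FockRepresentation J F) (n : ℕ) : R.wordSpan n →ₗ[ℂ] R.particleSpace n :=
  LinearMap.codRestrict _ (R.D.subtype ∘ₗ (R.wordSpan n).subtype)
    fun Φ => R.coe_mem_particleSpace Φ.2

theorem denseRange_wordInclusion (R : FockRepresentation J F) (n : ℕ) :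
    DenseRange (R.wordInclusion n) := by
  rw [DenseRange, Subtype.dense_iff]
  intro x hx
  refine R.particleSpace_induction
    (p := fun x => x ∈ closure (Subtype.val '' Set.range (R.wordInclusion n))) isClosed_closure
    (fun Φ hΦ => subset_closure ⟨_, ⟨⟨Φ, hΦ⟩, rfl⟩, rfl⟩) hx

variable [CompleteSpace F]

theorem summable_of_summable_norm_sq (R : FockRepresentation J F) {x : ℕ → F}
    (hx : ∀ n, x n ∈ R.particleSpace n) (h : Summable fun n => ‖x n‖ ^ 2) : Summable x :=
  (R.orthogonalFamily_particleSpace.summable_iff_norm_sq_summable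
    (fun n => (⟨x n, hx n⟩ : R.particleSpace n))).2 h

theorem component_mem (R : FockRepresentation J F) (n : ℕ) (x : F) :
    R.component n x ∈ R.particleSpace n := by
  have : CompleteSpace (R.particleSpace n) := (R.isClosed_particleSpace n).completeSpace_coe
  exact Submodule.starProjection_apply_mem _ _

theorem component_of_mem (R : FockRepresentation J F) {n : ℕ} {x : F}
    (hx : x ∈ R.particleSpace n) : R.component n x = x := by
  have : CompleteSpace (R.particleSpace n) := (R.isClosed_particleSpace n).completeSpace_coe
  exact Submodule.starProjection_eq_self_iff.2 hx

theorem component_of_mem_of_ne (R : FockRepresentation J F) {m n : ℕ} (hmn : m ≠ n) {x : F}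
    (hx : x ∈ R.particleSpace m) : R.component n x = 0 := by
  have : CompleteSpace (R.particleSpace n) := (R.isClosed_particleSpace n).completeSpace_coe
  refine (Submodule.starProjection_apply_eq_zero_iff _).2 ?_
  rw [Submodule.mem_orthogonal]
  exact fun u hu => R.inner_eq_zero_of_mem_particleSpace hmn.symm hu hx

theorem inner_component (R : FockRepresentation J F) {n : ℕ} {x : F}
    (hx : x ∈ R.particleSpace n) (y : F) : ⟪x, R.component n y⟫_ℂ = ⟪x, y⟫_ℂ := by
  have : CompleteSpace (R.particleSpace n) := (R.isClosed_particleSpace n).completeSpace_coe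
  conv_rhs => rw [← R.component_of_mem hx]
  exact ((R.particleSpace n).inner_starProjection_left_eq_right x y).symm ▸ rfl

theorem component_of_hasSum (R : FockRepresentation J F) {x : ℕ → F} {y : F}
    (hx : ∀ n, x n ∈ R.particleSpace n) (hy : HasSum x y) (m : ℕ) : R.component m y = x m := by
  have h1 := hy.mapL (R.component m)
  have h2 := hasSum_single (f := fun n => R.component m (x n)) m
    fun n hn => R.component_of_mem_of_ne hn (hx n)
  rw [h1.unique h2, R.component_of_mem (hx m)]

/-- Cyclicity of the vacuum makes the orthogonal sectors total, and continuity of the projections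
identifies the terms of the expansion. -/
theorem hasSum_component (R : FockRepresentation J F) (x : F) :
    HasSum (fun n => R.component n x) x := by
  have : ∀ n, CompleteSpace (R.particleSpace n) :=
    fun n => (R.isClosed_particleSpace n).completeSpace_coe
  have H : IsHilbertSum ℂ (fun n => R.particleSpace n)
      fun n => (R.particleSpace n).subtypeₗᵢ := by
    refine IsHilbertSum.mkInternal _ R.orthogonalFamily_particleSpace ?_
    rw [← (Submodule.dense_iff_topologicalClosure_eq_top.1 R.cyclic)]
    refine Submodule.topologicalClosure_mono (Submodule.span_le.2 ?_)
    rintro _ ⟨l, rfl⟩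
    exact Submodule.mem_iSup_of_mem l.length
      (R.coe_mem_particleSpace (Submodule.subset_span ⟨l, rfl, rfl⟩))
  have h := H.hasSum_linearIsometryEquiv_symm (H.linearIsometryEquiv x)
  rw [LinearIsometryEquiv.symm_apply_apply] at h
  have h2 := R.component_of_hasSum (fun n => (H.linearIsometryEquiv x n).2) h
  exact (funext h2 : (fun n => R.component n x) = _) ▸ h

/-- The bounded operator on `F` that agrees on algebraic `n`-particle vectors with `T` and
vanishes on the orthogonal complement of the `n`-particle space. Meaningful only if `T` is bounded
on algebraic `n`-particle vectors. -/
noncomputable def sectorExtension (R : FockRepresentation J F) (n : ℕ) (T : R.D →ₗ[ℂ] R.D) : F →L[ℂ] F :=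
  (((R.D.subtype ∘ₗ T) ∘ₗ (R.wordSpan n).subtype).extendOfNorm (R.wordInclusion n)) ∘L
    (R.component n).codRestrict (R.particleSpace n) (R.component_mem n)

theorem sectorExtension_component (R : FockRepresentation J F) (n : ℕ) (T : R.D →ₗ[ℂ] R.D)
    (x : F) : R.sectorExtension n T (R.component n x) = R.sectorExtension n T x := by
  simp only [sectorExtension, ContinuousLinearMap.comp_apply]
  congr 1
  ext
  exact R.component_of_mem (R.component_mem n x)

theorem sectorExtension_coe (R : FockRepresentation J F) {n : ℕ} {T : R.D →ₗ[ℂ] R.D} {c : ℝ}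
    (hT : ∀ Φ ∈ R.wordSpan n, ‖(T Φ : F)‖ ≤ c * ‖(Φ : F)‖) {Φ : R.D} (hΦ : Φ ∈ R.wordSpan n) :
    R.sectorExtension n T Φ = T Φ := by
  have h := LinearMap.extendOfNorm_eq (f := (R.D.subtype ∘ₗ T) ∘ₗ (R.wordSpan n).subtype)
    (R.denseRange_wordInclusion n) ⟨c, fun x => hT _ x.2⟩ ⟨Φ, hΦ⟩
  simp only [sectorExtension, ContinuousLinearMap.comp_apply]
  refine Eq.trans (congrArg _ ?_) h
  ext
  exact R.component_of_mem (R.coe_mem_particleSpace hΦ)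

theorem norm_sectorExtension_le (R : FockRepresentation J F) {n : ℕ} {T : R.D →ₗ[ℂ] R.D} {c : ℝ}
    (hT : ∀ Φ ∈ R.wordSpan n, ‖(T Φ : F)‖ ≤ c * ‖(Φ : F)‖) (x : F) :
    ‖R.sectorExtension n T x‖ ≤ c * ‖R.component n x‖ :=
  LinearMap.norm_extendOfNorm_apply_le (f := (R.D.subtype ∘ₗ T) ∘ₗ (R.wordSpan n).subtype)
    (R.denseRange_wordInclusion n) c (fun x => hT _ x.2) _

/-- A closed relation between argument and value survives limits of algebraic vectors. It is used
for membership in a sector, for equality of operators and for membership in the closure of a graph.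
-/
theorem sectorExtension_induction (R : FockRepresentation J F) {n : ℕ} {T : R.D →ₗ[ℂ] R.D} {c : ℝ}
    (hT : ∀ Φ ∈ R.wordSpan n, ‖(T Φ : F)‖ ≤ c * ‖(Φ : F)‖)
    {p : F → F → Prop} (hp : IsClosed {z : F × F | p z.1 z.2})
    (h : ∀ Φ ∈ R.wordSpan n, p (Φ : F) (T Φ : F)) (x : F) :
    p (R.component n x) (R.sectorExtension n T x) := by
  rw [← sectorExtension_component]
  refine R.particleSpace_induction (p := fun x => p x (R.sectorExtension n T x))
    (hp.preimage (by fun_prop : Continuous fun x => (x, R.sectorExtension n T x)))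
    (fun Φ hΦ => ?_) (R.component_mem n x)
  rw [R.sectorExtension_coe hT hΦ]
  exact h Φ hΦ

theorem sectorExtension_mem (R : FockRepresentation J F) {n : ℕ} {T : R.D →ₗ[ℂ] R.D} {c : ℝ}
    (hT : ∀ Φ ∈ R.wordSpan n, ‖(T Φ : F)‖ ≤ c * ‖(Φ : F)‖)
    {m : ℕ} (hm : ∀ Φ ∈ R.wordSpan n, T Φ ∈ R.wordSpan m) (x : F) :
    R.sectorExtension n T x ∈ R.particleSpace m :=
  R.sectorExtension_induction hT (p := fun _ y => y ∈ R.particleSpace m)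
    ((R.isClosed_particleSpace m).preimage continuous_snd)
    (fun Φ hΦ => R.coe_mem_particleSpace (hm Φ hΦ)) x

end FockRepresentation

/-! ### Graphs of compositions, sums and restrictions of partial operators -/

namespace LinearPMap

variable {E : Type*} [AddCommGroup E] [Module ℂ E]

theorem mem_graph_natComp {g f : E →ₗ.[ℂ] E} {x y z : E} (hf : (x, y) ∈ f.graph)
    (hg : (y, z) ∈ g.graph) : (x, z) ∈ (g.natComp f).graph := by
  rw [mem_graph_iff] at hf hg ⊢
  obtain ⟨x', rfl, rfl⟩ := hf
  obtain ⟨y', hy', rfl⟩ := hg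
  have hx : (x' : E) ∈ (g.natComp f).domain :=
    ⟨⟨x', (congrArg (· ∈ g.domain) hy').mp y'.2, rfl⟩, x'.2⟩
  refine ⟨⟨x', hx⟩, rfl, ?_⟩
  change g ⟨_, _⟩ = _
  congr 1
  ext
  exact hy'.symm

theorem mem_graph_sum {ι : Type*} {f : ι → E →ₗ.[ℂ] E} {s : Finset ι} {x : E} {y : ι → E}
    (h : ∀ j ∈ s, (x, y j) ∈ (f j).graph) : (x, ∑ j ∈ s, y j) ∈ (∑ j ∈ s, f j).graph := by
  classical
  induction s using Finset.induction_on with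
  | empty =>
    rw [mem_graph_iff]
    exact ⟨⟨x, trivial⟩, rfl, rfl⟩
  | insert j s hj ih =>
    rw [Finset.sum_insert hj, Finset.sum_insert hj]
    have h1 := h j (Finset.mem_insert_self j s)
    have h2 := ih fun i hi => h i (Finset.mem_insert_of_mem hi)
    rw [mem_graph_iff] at h1 h2 ⊢
    obtain ⟨x₁, hx₁, h1⟩ := h1
    obtain ⟨x₂, hx₂, h2⟩ := h2
    dsimp only at hx₁ hx₂ h1 h2 ⊢
    subst hx₁
    refine ⟨⟨x₁, x₁.2, hx₂ ▸ x₂.2⟩, rfl, ?_⟩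
    rw [add_apply, ← h1, ← h2]
    congr 2
    ext
    exact hx₂.symm

theorem mem_graph_domRestrict {f : E →ₗ.[ℂ] E} {S : Submodule ℂ E} {x y : E} (hx : x ∈ S)
    (h : (x, y) ∈ f.graph) : (x, y) ∈ (f.domRestrict S).graph := by
  rw [mem_graph_iff] at h ⊢
  obtain ⟨x', rfl, rfl⟩ := h
  exact ⟨⟨x', hx, x'.2⟩, rfl, domRestrict_apply rfl⟩

end LinearPMap

/-! ### The closures of a and a† on their natural domains -/

namespace FockRepresentation

variable {L : Type*} [NormedAddCommGroup L] [InnerProductSpace ℂ L] {J : Conjugation L}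
  {F : Type*} [NormedAddCommGroup F] [InnerProductSpace ℂ F] [CompleteSpace F]

/-- `T` is contained in the adjoint of the densely defined `S`, which is closed. -/
theorem isClosable_of_inner_eq (R : FockRepresentation J F) {S T : R.D →ₗ[ℂ] R.D}
    (h : ∀ Φ Ψ : R.D, ⟪(S Φ : F), (Ψ : F)⟫_ℂ = ⟪(Φ : F), (T Ψ : F)⟫_ℂ) :
    (R.toPMap T).IsClosable :=
  (LinearPMap.adjoint_isClosed (T := R.toPMap S) R.dense_D).isClosable.leIsClosable
    (LinearPMap.IsFormalAdjoint.le_adjoint (T := R.toPMap S) (S := R.toPMap T) R.dense_D fun Φ Ψ => h Φ Ψ)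

theorem isClosable_a (R : FockRepresentation J F) (f : L) : (R.toPMap (R.a f)).IsClosable :=
  R.isClosable_of_inner_eq (S := R.adag (J.toMap f)) fun Φ Ψ => by
    rw [inner_adag_left, J.involutive]

theorem isClosable_adag (R : FockRepresentation J F) (f : L) :
    (R.toPMap (R.adag f)).IsClosable :=
  R.isClosable_of_inner_eq (S := R.a (J.toMap f)) fun Φ Ψ => by
    rw [R.unitarity, J.involutive]

/-- Finite sums over sectors already lie in the closed graph, hence so does their limit; the sector
bounds `c n` may grow arbitrarily. -/
theorem mem_graph_closure_of_hasSum (R : FockRepresentation J F) {T : R.D →ₗ[ℂ] R.D}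
    (hcl : (R.toPMap T).IsClosable) {c : ℕ → ℝ}
    (hT : ∀ n, ∀ Φ ∈ R.wordSpan n, ‖(T Φ : F)‖ ≤ c n * ‖(Φ : F)‖) {x y : F}
    (h : HasSum (fun n => R.sectorExtension n T x) y) : (x, y) ∈ (R.toPMap T).closure.graph := by
  rw [← hcl.graph_closure_eq_closure_graph]
  have h2 := (R.hasSum_component x).prodMk h
  refine (Submodule.isClosed_topologicalClosure _).mem_of_tendsto h2
    (Eventually.of_forall fun s => sum_mem fun n _ => ?_)
  refine R.sectorExtension_induction (hT n)
    (p := fun x y => (x, y) ∈ (R.toPMap T).graph.topologicalClosure)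
    (Submodule.isClosed_topologicalClosure _) (fun Φ _ => ?_) x
  exact Submodule.le_topologicalClosure _ ((R.toPMap T).mem_graph Φ)

theorem sectorExtension_eq (R : FockRepresentation J F) {n : ℕ} {T : R.D →ₗ[ℂ] R.D} {c : ℝ}
    (hT : ∀ Φ ∈ R.wordSpan n, ‖(T Φ : F)‖ ≤ c * ‖(Φ : F)‖) {S : F →L[ℂ] F}
    (hS : ∀ x, S (R.component n x) = S x) (h : ∀ Φ ∈ R.wordSpan n, S Φ = T Φ) (x : F) :
    R.sectorExtension n T x = S x := by
  rw [← hS]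
  exact (R.sectorExtension_induction hT (p := fun x y => y = S x)
    (isClosed_eq continuous_snd (by fun_prop)) (fun Φ hΦ => (h Φ hΦ).symm) x)

theorem sectorExtension_eq_zero (R : FockRepresentation J F) {n : ℕ} {T : R.D →ₗ[ℂ] R.D}
    (hT : ∀ Φ ∈ R.wordSpan n, T Φ = 0) (x : F) : R.sectorExtension n T x = 0 :=
  R.sectorExtension_eq (c := 0) (S := 0) (fun Φ hΦ => by simp [hT Φ hΦ]) (fun _ => rfl)
    (fun Φ hΦ => by simp [hT Φ hΦ]) x

theorem mem_domainPow_half (R : FockRepresentation J F) {x : F} :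
    x ∈ R.domainPow (1 / 2) ↔ Summable fun n : ℕ => ((n : ℝ) + 1) * ‖R.component n x‖ ^ 2 := by
  change Summable (fun n : ℕ => ((n : ℝ) + 1) ^ (2 * (1 / 2 : ℝ)) * ‖R.component n x‖ ^ 2) ↔ _
  norm_num

theorem mem_domainPow_one (R : FockRepresentation J F) {x : F} :
    x ∈ R.domainPow 1 ↔ Summable fun n : ℕ => ((n : ℝ) + 1) ^ 2 * ‖R.component n x‖ ^ 2 := by
  change Summable (fun n : ℕ => ((n : ℝ) + 1) ^ (2 * (1 : ℝ)) * ‖R.component n x‖ ^ 2) ↔ _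
  norm_num

theorem domainPow_one_le_half (R : FockRepresentation J F) :
    R.domainPow 1 ≤ R.domainPow (1 / 2) := by
  intro x hx
  rw [mem_domainPow_one] at hx
  rw [mem_domainPow_half]
  refine hx.of_nonneg_of_le (fun n => by positivity) fun n => ?_
  gcongr
  nlinarith [(Nat.cast_nonneg n : (0 : ℝ) ≤ n)]

theorem norm_sectorExtension_a_le (R : FockRepresentation J F) (f : L) (n : ℕ) (x : F) :
    ‖R.sectorExtension n (R.a f) x‖ ^ 2 ≤ ‖f‖ ^ 2 * (n * ‖R.component n x‖ ^ 2) := by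
  refine (pow_le_pow_left₀ (norm_nonneg _)
    (R.norm_sectorExtension_le (fun Φ hΦ => R.norm_a_le f hΦ) x) 2).trans_eq ?_
  rw [mul_pow, mul_pow, Real.sq_sqrt (by positivity)]
  ring

theorem norm_sectorExtension_adag_le (R : FockRepresentation J F) (f : L) (n : ℕ) (x : F) :
    ‖R.sectorExtension n (R.adag f) x‖ ^ 2 ≤ ‖f‖ ^ 2 * ((n + 1) * ‖R.component n x‖ ^ 2) := by
  refine (pow_le_pow_left₀ (norm_nonneg _)
    (R.norm_sectorExtension_le (fun Φ hΦ => R.norm_adag_le f hΦ) x) 2).trans_eq ?_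
  rw [mul_pow, mul_pow, Real.sq_sqrt (by positivity)]
  ring

theorem sectorExtension_a_mem (R : FockRepresentation J F) (f : L) (n : ℕ) (x : F) :
    R.sectorExtension (n + 1) (R.a f) x ∈ R.particleSpace n :=
  R.sectorExtension_mem (fun _ hΦ => R.norm_a_le f hΦ) (fun _ hΦ => R.a_mem_wordSpan f hΦ) x

theorem sectorExtension_adag_mem (R : FockRepresentation J F) (f : L) (n : ℕ) (x : F) :
    R.sectorExtension n (R.adag f) x ∈ R.particleSpace (n + 1) :=
  R.sectorExtension_mem (fun _ hΦ => R.norm_adag_le f hΦ) (fun _ hΦ => R.adag_mem_wordSpan f hΦ) x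

theorem exists_mem_graph_aExt (R : FockRepresentation J F) (f : L) {x : F}
    (hx : x ∈ R.domainPow (1 / 2)) : ∃ y, (x, y) ∈ (R.aExt f).graph ∧
      ∀ n, R.component n y = R.sectorExtension (n + 1) (R.a f) x := by
  have hsum : Summable fun n => R.sectorExtension (n + 1) (R.a f) x := by
    refine R.summable_of_summable_norm_sq (R.sectorExtension_a_mem f · x) ?_
    rw [mem_domainPow_half] at hx
    refine (((summable_nat_add_iff 1).2 hx).mul_left (‖f‖ ^ 2)).of_nonneg_of_le
      (fun _ => sq_nonneg _) fun n => (R.norm_sectorExtension_a_le f (n + 1) x).trans ?_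
    gcongr
    simp
  obtain ⟨y, hy⟩ := hsum
  refine ⟨y, ?_, fun n => R.component_of_hasSum (R.sectorExtension_a_mem f · x) hy n⟩
  refine LinearPMap.mem_graph_domRestrict hx (R.mem_graph_closure_of_hasSum (R.isClosable_a f)
    (fun n Φ hΦ => R.norm_a_le f hΦ) ?_)
  -- The unshifted series has one more term, from the sector `n = 0`, which vanishes because `a f`
  -- kills the vacuum.
  have h := (hasSum_nat_add_iff (f := fun n => R.sectorExtension n (R.a f) x) 1).1 hy
  simpa [R.sectorExtension_eq_zero (n := 0) (fun Φ hΦ => R.a_wordSpan_zero f hΦ)] using h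

theorem exists_mem_graph_adagExt (R : FockRepresentation J F) (f : L) {x : F}
    (hx : x ∈ R.domainPow (1 / 2)) : ∃ y, (x, y) ∈ (R.adagExt f).graph ∧
      HasSum (fun n => R.sectorExtension n (R.adag f) x) y := by
  have hsum : Summable fun n => R.sectorExtension n (R.adag f) x := by
    -- Shifting by one, with `0` in front, puts the `n`-th term into the `n`-particle space, so that
    -- orthogonality applies.
    let z : ℕ → F := fun n => Nat.casesOn n 0 fun n => R.sectorExtension n (R.adag f) x
    refine (summable_nat_add_iff (f := z) 1).2 (R.summable_of_summable_norm_sq (x := z) ?_ ?_)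
    · rintro (_ | n)
      · exact zero_mem _
      · exact R.sectorExtension_adag_mem f n x
    · refine (summable_nat_add_iff 1).1 ?_
      rw [mem_domainPow_half] at hx
      exact (hx.mul_left (‖f‖ ^ 2)).of_nonneg_of_le (fun _ => sq_nonneg _)
        fun n => R.norm_sectorExtension_adag_le f n x
  obtain ⟨y, hy⟩ := hsum
  exact ⟨y, LinearPMap.mem_graph_domRestrict hx (R.mem_graph_closure_of_hasSum
    (R.isClosable_adag f) (fun n Φ hΦ => R.norm_adag_le f hΦ) hy), hy⟩

/-- Annihilation costs one factor `n` in the squared norm, so it maps `D_1` into `D_{1/2}`, where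
the creator is defined. -/
theorem exists_mem_graph_natComp (R : FockRepresentation J F) (f g : L) {x : F}
    (hx : x ∈ R.domainPow 1) : ∃ y, (x, y) ∈ ((R.adagExt g).natComp (R.aExt f)).graph ∧
      HasSum (fun n => R.sectorExtension n (R.adag g ∘ₗ R.a f) x) y := by
  obtain ⟨χ, hχ, hcomp⟩ := R.exists_mem_graph_aExt f (R.domainPow_one_le_half hx)
  have hχmem : χ ∈ R.domainPow (1 / 2) := by
    rw [mem_domainPow_half]
    rw [mem_domainPow_one] at hx
    refine (((summable_nat_add_iff 1).2 hx).mul_left (‖f‖ ^ 2)).of_nonneg_of_le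
      (fun _ => by positivity) fun n => ?_
    rw [hcomp]
    refine (mul_le_mul_of_nonneg_left (R.norm_sectorExtension_a_le f (n + 1) x)
      (by positivity)).trans ?_
    have h1 : ((n : ℝ) + 1) * (n + 1) ≤ (n + 1 + 1) ^ 2 := by
      nlinarith [(Nat.cast_nonneg n : (0 : ℝ) ≤ n)]
    push_cast
    calc _ = ‖f‖ ^ 2 * ((((n : ℝ) + 1) * (n + 1)) * ‖R.component (n + 1) x‖ ^ 2) := by ring
      _ ≤ _ := by gcongr
  obtain ⟨y, hy, hsum⟩ := R.exists_mem_graph_adagExt g hχmem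
  refine ⟨y, LinearPMap.mem_graph_natComp hχ hy, ?_⟩
  have h1 : ∀ n, R.sectorExtension (n + 1) (R.adag g ∘ₗ R.a f) x =
      R.sectorExtension n (R.adag g) χ := by
    intro n
    rw [← R.sectorExtension_component n _ χ, hcomp]
    refine R.sectorExtension_eq (fun Φ hΦ => R.norm_adag_a_le f g hΦ)
      (S := R.sectorExtension n (R.adag g) ∘L R.sectorExtension (n + 1) (R.a f)) ?_ ?_ x
    · intro x
      simp only [ContinuousLinearMap.comp_apply, sectorExtension_component]
    · intro Φ hΦ
      rw [ContinuousLinearMap.comp_apply,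
        R.sectorExtension_coe (fun Φ hΦ => R.norm_a_le f hΦ) hΦ,
        R.sectorExtension_coe (fun Φ hΦ => R.norm_adag_le g hΦ) (R.a_mem_wordSpan f hΦ)]
      rfl
  have h := (hasSum_nat_add_iff
    (f := fun n => R.sectorExtension n (R.adag g ∘ₗ R.a f) x) 1).1
    (by simpa only [h1] using hsum)
  simpa [R.sectorExtension_eq_zero (n := 0) (T := R.adag g ∘ₗ R.a f)
    (fun Φ hΦ => by simp [R.a_wordSpan_zero f hΦ])] using h

variable [CompleteSpace L]

theorem sectorExtension_pairSum (R : FockRepresentation J F) (e : HilbertBasis ℕ ℂ L)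
    (B : L →L[ℂ] L) (M n : ℕ) (x : F) :
    R.sectorExtension n (R.pairSum (fun j => B (e j)) e M) x =
      ∑ j ∈ Finset.range M,
        R.sectorExtension n (R.adag (B (e j)) ∘ₗ R.a (J.toMap (e j))) x := by
  rw [R.sectorExtension_eq (fun Φ hΦ => R.norm_pairSum_le e B M hΦ)
    (S := ∑ j ∈ Finset.range M,
        R.sectorExtension n (R.adag (B (e j)) ∘ₗ R.a (J.toMap (e j))))]
  · simp
  · intro x
    simp only [_root_.sum_apply, sectorExtension_component]
  · intro Φ hΦ
    rw [pairSum_apply, _root_.sum_apply, Submodule.coe_sum]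
    exact Finset.sum_congr rfl fun j _ =>
      R.sectorExtension_coe (fun Φ hΦ => R.norm_adag_a_le _ _ hΦ) hΦ

theorem exists_mem_graph_dGammaPartial (R : FockRepresentation J F) (e : HilbertBasis ℕ ℂ L)
    (B : L →L[ℂ] L) (M : ℕ) {x : F} (hx : x ∈ R.domainPow 1) :
    ∃ y, (x, y) ∈ (R.dGammaPartial e B M).graph ∧
      HasSum (fun n => R.sectorExtension n (R.pairSum (fun j => B (e j)) e M) x) y := by
  choose y hy hsum using fun j : ℕ => R.exists_mem_graph_natComp (J.toMap (e j)) (B (e j)) hx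
  refine ⟨∑ j ∈ Finset.range M, y j, LinearPMap.mem_graph_sum fun j _ => hy j, ?_⟩
  simp only [sectorExtension_pairSum]
  exact hasSum_sum fun j _ => hsum j

end FockRepresentation

/-! ### Convergence to dΓ(B), sector by sector and on D_1 -/

/-- The vectors at which a bounded family of operators converges form a closed set. -/
theorem isClosed_setOf_exists_tendsto {ι E F : Type*} [NormedAddCommGroup E] [NormedSpace ℂ E]
    [NormedAddCommGroup F] [NormedSpace ℂ F] [CompleteSpace F] {l : Filter ι} [l.NeBot]
    {S : ι → E →L[ℂ] F} {C : ℝ} (hC : ∀ i x, ‖S i x‖ ≤ C * ‖x‖) :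
    IsClosed {x | ∃ y, Tendsto (fun i => S i x) l (𝓝 y)} := by
  refine isClosed_of_closure_subset fun x hx => ?_
  refine cauchy_map_iff_exists_tendsto.1 (Metric.cauchy_iff.2 ⟨inferInstance, fun ε hε => ?_⟩)
  have hδ : 0 < ε / (4 * (|C| + 1)) := by positivity
  obtain ⟨x', ⟨y, hy⟩, hx'⟩ := Metric.mem_closure_iff.1 hx _ hδ
  have hclose : ∀ i, dist (S i x) (S i x') < ε / 4 := by
    intro i
    rw [dist_eq_norm, ← map_sub]
    rw [dist_eq_norm] at hx'
    calc ‖S i (x - x')‖ ≤ C * ‖x - x'‖ := hC i _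
      _ ≤ (|C| + 1) * ‖x - x'‖ := by gcongr; linarith [le_abs_self C]
      _ < (|C| + 1) * (ε / (4 * (|C| + 1))) := by gcongr
      _ = ε / 4 := by field_simp
  refine ⟨_, image_mem_map (hy (Metric.ball_mem_nhds y (by positivity : 0 < ε / 4))), ?_⟩
  rintro _ ⟨i, hi, rfl⟩ _ ⟨j, hj, rfl⟩
  have hi' : dist (S i x') y < ε / 4 := hi
  have hj' : dist (S j x') y < ε / 4 := hj
  have h1 := dist_triangle4 (S i x) (S i x') (S j x') (S j x)
  have h2 := dist_triangle_right (S i x') (S j x') y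
  have h3 := hclose j
  rw [dist_comm] at h3
  linarith [hclose i]

namespace FockRepresentation

variable {L : Type*} [NormedAddCommGroup L] [InnerProductSpace ℂ L] {J : Conjugation L}
  {F : Type*} [NormedAddCommGroup F] [InnerProductSpace ℂ F] [CompleteSpace F]

theorem dense_domainPow_one (R : FockRepresentation J F) : Dense (R.domainPow 1 : Set F) := by
  refine R.cyclic.mono (SetLike.coe_subset_coe.2 (Submodule.span_le.2 ?_))
  rintro _ ⟨l, rfl⟩
  have h := R.coe_mem_particleSpace
    (Submodule.subset_span ⟨l, rfl, rfl⟩ : _ ∈ R.wordSpan l.length)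
  refine R.mem_domainPow_one.2 (summable_of_ne_finset_zero (s := {l.length}) fun n hn => ?_)
  rw [R.component_of_mem_of_ne (fun h => hn (by simp [h])) h]
  simp

theorem norm_component_le (R : FockRepresentation J F) (n : ℕ) (x : F) :
    ‖R.component n x‖ ≤ ‖x‖ := by
  have : CompleteSpace (R.particleSpace n) := (R.isClosed_particleSpace n).completeSpace_coe
  exact Submodule.norm_starProjection_apply_le _ x

theorem summable_sq_mul_norm_component (R : FockRepresentation J F) {x : F}
    (hx : x ∈ R.domainPow 1) (C : ℝ) :
    Summable fun n : ℕ => (C * n * ‖R.component n x‖) ^ 2 := by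
  refine ((R.mem_domainPow_one.1 hx).mul_left (C ^ 2)).of_nonneg_of_le
    (fun _ => sq_nonneg _) fun n => ?_
  rw [mul_pow, mul_pow, mul_assoc]
  gcongr
  linarith

/-- The restriction of the partial sum `∑_{j < M} a†(B e_j) a(ē_j)` to the closed `n`-particle
space, as a bounded operator on `F`. -/
noncomputable def dGammaPartialSector (R : FockRepresentation J F) (e : HilbertBasis ℕ ℂ L)
    (B : L →L[ℂ] L) (M n : ℕ) : F →L[ℂ] F :=
  R.sectorExtension n (R.pairSum (fun j => B (e j)) e M)

variable [CompleteSpace L]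

theorem dGammaPartialSector_coe (R : FockRepresentation J F) (e : HilbertBasis ℕ ℂ L)
    (B : L →L[ℂ] L) (M : ℕ) {n : ℕ} {Φ : R.D} (hΦ : Φ ∈ R.wordSpan n) :
    R.dGammaPartialSector e B M n Φ = R.pairSum (fun j => B (e j)) e M Φ :=
  R.sectorExtension_coe (fun _ hΦ => R.norm_pairSum_le e B M hΦ) hΦ

theorem dGammaPartialSector_mem (R : FockRepresentation J F) (e : HilbertBasis ℕ ℂ L)
    (B : L →L[ℂ] L) (M n : ℕ) (x : F) : R.dGammaPartialSector e B M n x ∈ R.particleSpace n :=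
  R.sectorExtension_mem (fun _ hΦ => R.norm_pairSum_le e B M hΦ)
    (fun _ hΦ => R.pairSum_mem_wordSpan _ _ M hΦ) x

theorem norm_dGammaPartialSector_le (R : FockRepresentation J F) (e : HilbertBasis ℕ ℂ L)
    (B : L →L[ℂ] L) (M n : ℕ) (x : F) :
    ‖R.dGammaPartialSector e B M n x‖ ≤ ‖B‖ * n * ‖R.component n x‖ :=
  R.norm_sectorExtension_le (fun _ hΦ => R.norm_pairSum_le e B M hΦ) x

variable [Nonempty (HilbertBasis ℕ ℂ L)]

theorem exists_tendsto_dGammaPartialSector (R : FockRepresentation J F) (B : L →L[ℂ] L) (n : ℕ)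
    (x : F) : ∃ y, ∀ e : HilbertBasis ℕ ℂ L,
      Tendsto (fun M => R.dGammaPartialSector e B M n x) atTop (𝓝 y) := by
  -- Convergence along this supremum of filters means convergence to one common limit for every
  -- basis. A single density argument thus gives existence and independence of the basis.
  let l : Filter (HilbertBasis ℕ ℂ L × ℕ) := ⨆ e, map (Prod.mk e) atTop
  have hl : ∀ (x y : F), Tendsto (fun i : HilbertBasis ℕ ℂ L × ℕ =>
      R.dGammaPartialSector i.1 B i.2 n x) l (𝓝 y) ↔ ∀ e : HilbertBasis ℕ ℂ L,
      Tendsto (fun M => R.dGammaPartialSector e B M n x) atTop (𝓝 y) := by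
    intro x y
    simp only [l, tendsto_iSup, tendsto_map'_iff]
    rfl
  have hne : l.NeBot := by
    obtain ⟨e⟩ := ‹Nonempty (HilbertBasis ℕ ℂ L)›
    exact (map_neBot (f := atTop) (m := Prod.mk e)).mono (le_iSup (fun e => map (Prod.mk e) atTop) e)
  simp only [← hl]
  have h := R.particleSpace_induction
    (isClosed_setOf_exists_tendsto (l := l)
      (S := fun i : HilbertBasis ℕ ℂ L × ℕ => R.dGammaPartialSector i.1 B i.2 n)
      (C := ‖B‖ * n) fun i x => (R.norm_dGammaPartialSector_le i.1 B i.2 n x).trans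
        (mul_le_mul_of_nonneg_left (R.norm_component_le n x) (by positivity)))
    (fun Φ hΦ => ?_) (R.component_mem n x)
  · simpa only [dGammaPartialSector, sectorExtension_component] using h
  · obtain ⟨Ψ, -, H⟩ := R.exists_tendsto_pairSum B hΦ
    refine ⟨Ψ, (hl _ _).2 fun e => ?_⟩
    simp only [R.dGammaPartialSector_coe e B _ hΦ]
    exact H _ _ (e.tendsto_sum_inner_smul B)

theorem exists_sectorLimit (R : FockRepresentation J F) (B : L →L[ℂ] L) (n : ℕ) :
    ∃ G : F →L[ℂ] F, ∀ (e : HilbertBasis ℕ ℂ L) (x : F),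
      Tendsto (fun M => R.dGammaPartialSector e B M n x) atTop (𝓝 (G x)) := by
  choose G hG using R.exists_tendsto_dGammaPartialSector B n
  obtain ⟨e⟩ := ‹Nonempty (HilbertBasis ℕ ℂ L)›
  refine ⟨LinearMap.mkContinuous
    { toFun := G
      map_add' := fun x y => tendsto_nhds_unique (hG (x + y) e)
        (by simpa only [map_add] using (hG x e).add (hG y e))
      map_smul' := fun c x => tendsto_nhds_unique (hG (c • x) e)
        (by simpa only [map_smul, RingHom.id_apply] using (hG x e).const_smul c) } (‖B‖ * n) fun x => ?_,
    fun e x => hG x e⟩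
  exact le_of_tendsto' (hG x e).norm fun M => (R.norm_dGammaPartialSector_le e B M n x).trans
    (mul_le_mul_of_nonneg_left (R.norm_component_le n x) (by positivity))

/-- The restriction of `dΓ(B)` to the closed `n`-particle space, as a bounded operator on `F`. -/
noncomputable def dGammaSector (R : FockRepresentation J F) (B : L →L[ℂ] L) (n : ℕ) : F →L[ℂ] F :=
  (R.exists_sectorLimit B n).choose

theorem tendsto_dGammaPartialSector (R : FockRepresentation J F) (e : HilbertBasis ℕ ℂ L)
    (B : L →L[ℂ] L) (n : ℕ) (x : F) :
    Tendsto (fun M => R.dGammaPartialSector e B M n x) atTop (𝓝 (R.dGammaSector B n x)) :=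
  (R.exists_sectorLimit B n).choose_spec e x

theorem dGammaSector_mem (R : FockRepresentation J F) (B : L →L[ℂ] L) (n : ℕ) (x : F) :
    R.dGammaSector B n x ∈ R.particleSpace n := by
  obtain ⟨e⟩ := ‹Nonempty (HilbertBasis ℕ ℂ L)›
  exact (R.isClosed_particleSpace n).mem_of_tendsto (R.tendsto_dGammaPartialSector e B n x)
    (Eventually.of_forall fun M => R.dGammaPartialSector_mem e B M n x)

theorem norm_dGammaSector_le (R : FockRepresentation J F) (B : L →L[ℂ] L) (n : ℕ) (x : F) :
    ‖R.dGammaSector B n x‖ ≤ ‖B‖ * n * ‖R.component n x‖ := by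
  obtain ⟨e⟩ := ‹Nonempty (HilbertBasis ℕ ℂ L)›
  exact le_of_tendsto' (R.tendsto_dGammaPartialSector e B n x).norm
    fun M => R.norm_dGammaPartialSector_le e B M n x

theorem dGammaSector_component (R : FockRepresentation J F) (B : L →L[ℂ] L) (n : ℕ) (x : F) :
    R.dGammaSector B n (R.component n x) = R.dGammaSector B n x := by
  obtain ⟨e⟩ := ‹Nonempty (HilbertBasis ℕ ℂ L)›
  refine tendsto_nhds_unique (R.tendsto_dGammaPartialSector e B n _) ?_
  simpa only [dGammaPartialSector, sectorExtension_component] using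
    R.tendsto_dGammaPartialSector e B n x

theorem dGammaSector_id (R : FockRepresentation J F) (n : ℕ) (x : F) :
    R.dGammaSector (ContinuousLinearMap.id ℂ L) n x = (n : ℂ) • R.component n x := by
  rw [← dGammaSector_component]
  refine R.particleSpace_induction
    (p := fun x => R.dGammaSector (ContinuousLinearMap.id ℂ L) n x = (n : ℂ) • x)
    (isClosed_eq (by fun_prop) (by fun_prop)) (fun Φ hΦ => ?_) (R.component_mem n x)
  obtain ⟨e⟩ := ‹Nonempty (HilbertBasis ℕ ℂ L)›
  refine tendsto_nhds_unique (R.tendsto_dGammaPartialSector e _ n _) ?_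
  simp only [R.dGammaPartialSector_coe e _ _ hΦ]
  exact R.tendsto_pairSum_of_tendsto_id (e.tendsto_sum_inner_smul _) hΦ

theorem inner_dGammaSector (R : FockRepresentation J F) (B : L →L[ℂ] L) (n : ℕ) (x y : F) :
    ⟪R.dGammaSector B n x, y⟫_ℂ =
      ⟪x, R.dGammaSector (ContinuousLinearMap.adjoint B) n y⟫_ℂ := by
  have key : ⟪R.dGammaSector B n (R.component n x), R.component n y⟫_ℂ =
      ⟪R.component n x, R.dGammaSector (ContinuousLinearMap.adjoint B) n (R.component n y)⟫_ℂ := by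
    refine R.particleSpace_induction (p := fun x => ⟪R.dGammaSector B n x, R.component n y⟫_ℂ =
      ⟪x, R.dGammaSector (ContinuousLinearMap.adjoint B) n (R.component n y)⟫_ℂ)
      (isClosed_eq (by fun_prop) (by fun_prop)) (fun Φ hΦ => ?_) (R.component_mem n x)
    refine R.particleSpace_induction (p := fun y => ⟪R.dGammaSector B n Φ, y⟫_ℂ =
      ⟪(Φ : F), R.dGammaSector (ContinuousLinearMap.adjoint B) n y⟫_ℂ)
      (isClosed_eq (by fun_prop) (by fun_prop)) (fun Ψ hΨ => ?_) (R.component_mem n y)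
    obtain ⟨e⟩ := ‹Nonempty (HilbertBasis ℕ ℂ L)›
    -- Both families of sums, from the pairs `(B* e_j, e_j)` and `(e_j, B e_j)`, have one-particle
    -- limit `B*`, so `H` gives them the same limit `Ψ'`.
    obtain ⟨Ψ', -, H⟩ := R.exists_tendsto_pairSum (ContinuousLinearMap.adjoint B) hΨ
    have h1 := (R.tendsto_dGammaPartialSector e B n Φ).inner (𝕜 := ℂ)
      (tendsto_const_nhds (x := (Ψ : F)))
    have h2 := R.tendsto_dGammaPartialSector e (ContinuousLinearMap.adjoint B) n Ψ
    simp only [R.dGammaPartialSector_coe e _ _ hΦ, inner_pairSum_swap] at h1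
    simp only [R.dGammaPartialSector_coe e _ _ hΨ] at h2
    rw [tendsto_nhds_unique h2 (H _ _ (e.tendsto_sum_inner_smul _))]
    exact tendsto_nhds_unique h1 ((tendsto_const_nhds (x := (Φ : F))).inner (𝕜 := ℂ)
      (H _ _ (e.tendsto_sum_inner_map_smul B)))
  -- The projections on the other arguments are redundant, since sector operators take values in the
  -- sector.
  rw [dGammaSector_component, dGammaSector_component,
    R.inner_component (R.dGammaSector_mem B n x)] at key
  rw [key, ← inner_conj_symm, R.inner_component (R.dGammaSector_mem _ n y), inner_conj_symm]

theorem summable_dGammaSector (R : FockRepresentation J F) (B : L →L[ℂ] L) {x : F}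
    (hx : x ∈ R.domainPow 1) : Summable fun n => R.dGammaSector B n x := by
  refine R.summable_of_summable_norm_sq (R.dGammaSector_mem B · x) ?_
  exact (R.summable_sq_mul_norm_component hx ‖B‖).of_nonneg_of_le (fun _ => sq_nonneg _)
    fun n => pow_le_pow_left₀ (norm_nonneg _) (R.norm_dGammaSector_le B n x) 2

/-- The second quantization `dΓ(B)` on `D_1`, as the sum of its `n`-particle parts. -/
noncomputable def dGamma (R : FockRepresentation J F) (B : L →L[ℂ] L) : R.domainPow 1 →ₗ[ℂ] F where
  toFun Φ := ∑' n, R.dGammaSector B n Φ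
  map_add' Φ Ψ := by
    simp only [Submodule.coe_add, map_add]
    exact (R.summable_dGammaSector B Φ.2).tsum_add (R.summable_dGammaSector B Ψ.2)
  map_smul' c Φ := by
    simp only [Submodule.coe_smul, map_smul, RingHom.id_apply]
    exact (R.summable_dGammaSector B Φ.2).tsum_const_smul c

theorem hasSum_dGamma (R : FockRepresentation J F) (B : L →L[ℂ] L) (Φ : R.domainPow 1) :
    HasSum (fun n => R.dGammaSector B n Φ) (R.dGamma B Φ) :=
  (R.summable_dGammaSector B Φ.2).hasSum

/-- By Pythagoras it suffices to compare sectors, where `N` is exactly multiplication by `n`. -/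
theorem norm_dGamma_le (R : FockRepresentation J F) (B : L →L[ℂ] L) (Φ : R.domainPow 1) :
    ‖R.dGamma B Φ‖ ≤ ‖B‖ * ‖R.dGamma (ContinuousLinearMap.id ℂ L) Φ‖ := by
  have h1 := R.hasSum_norm_sq (R.dGammaSector_mem B · Φ) (R.hasSum_dGamma B Φ)
  have h2 := (R.hasSum_norm_sq (R.dGammaSector_mem _ · Φ)
    (R.hasSum_dGamma (ContinuousLinearMap.id ℂ L) Φ)).mul_left (‖B‖ ^ 2)
  refine abs_le_of_sq_le_sq' ?_ (by positivity) |>.2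
  rw [mul_pow]
  refine hasSum_le (fun n => ?_) h1 h2
  rw [dGammaSector_id, norm_smul, ← mul_pow]
  refine pow_le_pow_left₀ (norm_nonneg _) ((R.norm_dGammaSector_le B n Φ).trans_eq ?_) 2
  simp [mul_assoc]

theorem inner_dGamma (R : FockRepresentation J F) (B : L →L[ℂ] L) (Φ Ψ : R.domainPow 1) :
    ⟪R.dGamma B Φ, (Ψ : F)⟫_ℂ = ⟪(Φ : F), R.dGamma (ContinuousLinearMap.adjoint B) Ψ⟫_ℂ := by
  have h1 := (R.hasSum_dGamma (ContinuousLinearMap.adjoint B) Ψ).mapL (innerSL ℂ (Φ : F))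
  have h2 := (R.hasSum_dGamma B Φ).mapL (innerSL ℂ (Ψ : F))
  have h3 := h2.star
  simp only [innerSL_apply_apply, RCLike.star_def, inner_conj_symm, inner_dGammaSector] at h1 h3
  exact h3.unique h1

/-- The squared distance is the sum over sectors of squared distances. Each tends to zero and is at
most `(2 ‖B‖ n ‖Φ⁽ⁿ⁾‖)²`, which is summable on `D_1`. -/
theorem tendsto_of_hasSum_dGammaPartialSector (R : FockRepresentation J F)
    (e : HilbertBasis ℕ ℂ L) (B : L →L[ℂ] L) (Φ : R.domainPow 1) {y : ℕ → F}
    (hy : ∀ M, HasSum (fun n => R.dGammaPartialSector e B M n Φ) (y M)) :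
    Tendsto y atTop (𝓝 (R.dGamma B Φ)) := by
  have hsq : ∀ M, ‖y M - R.dGamma B Φ‖ ^ 2 =
      ∑' n, ‖R.dGammaPartialSector e B M n Φ - R.dGammaSector B n Φ‖ ^ 2 := fun M =>
    (R.hasSum_norm_sq (fun n => sub_mem (R.dGammaPartialSector_mem e B M n Φ)
      (R.dGammaSector_mem B n Φ)) ((hy M).sub (R.hasSum_dGamma B Φ))).tsum_eq.symm
  have hlim : Tendsto (fun M => ‖y M - R.dGamma B Φ‖ ^ 2) atTop (𝓝 0) := by
    simp only [hsq]
    have h := tendsto_tsum_of_dominated_convergence (𝓕 := atTop)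
      (f := fun M n => ‖R.dGammaPartialSector e B M n Φ - R.dGammaSector B n Φ‖ ^ 2)
      (g := fun _ => (0 : ℝ)) (R.summable_sq_mul_norm_component Φ.2 (2 * ‖B‖)) (fun n => ?_)
      (Eventually.of_forall fun M n => ?_)
    · simpa using h
    · simpa using
        (tendsto_iff_norm_sub_tendsto_zero.1 (R.tendsto_dGammaPartialSector e B n Φ)).pow 2
    · rw [Real.norm_of_nonneg (sq_nonneg _)]
      refine pow_le_pow_left₀ (norm_nonneg _) ((norm_sub_le _ _).trans ?_) 2
      linarith [R.norm_dGammaPartialSector_le e B M n Φ, R.norm_dGammaSector_le B n Φ]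
  rw [tendsto_iff_norm_sub_tendsto_zero]
  have h := hlim.sqrt
  simpa only [Real.sqrt_sq (norm_nonneg _), Real.sqrt_zero] using h

end FockRepresentation

theorem theorem5 {L : Type*} [NormedAddCommGroup L] [InnerProductSpace ℂ L] [CompleteSpace L]
    [TopologicalSpace.SeparableSpace L] (hL : ¬ FiniteDimensional ℂ L)
    {F : Type*} [NormedAddCommGroup F] [InnerProductSpace ℂ F] [CompleteSpace F]
    (J : Conjugation L) (R : FockRepresentation J F) :
    Dense (R.domainPow 1 : Set F) ∧
    -- all partial sums are defined on `D_1`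
    ∃ hdom : ∀ (e : HilbertBasis ℕ ℂ L) (B : L →L[ℂ] L) (M : ℕ),
      R.domainPow 1 ≤ (R.dGammaPartial e B M).domain,
    ∃ dΓ : (L →L[ℂ] L) → (R.domainPow 1 →ₗ[ℂ] F),
      -- strong convergence on `D_1`, with a limit that does not depend on the basis
      (∀ (B : L →L[ℂ] L) (e : HilbertBasis ℕ ℂ L) (Φ : R.domainPow 1),
        Tendsto (fun M : ℕ => R.dGammaPartial e B M (Submodule.inclusion (hdom e B M) Φ))
          atTop (𝓝 (dΓ B Φ))) ∧
      -- the bound, where `N = dΓ(id)`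
      (∀ (B : L →L[ℂ] L) (Φ : R.domainPow 1),
        ‖dΓ B Φ‖ ≤ ‖B‖ * ‖dΓ (ContinuousLinearMap.id ℂ L) Φ‖) ∧
      -- the adjoint of `dΓ(B)` (with domain `D_1`) is defined on `D_1` and equals `dΓ(B*)` there
      (∀ B : L →L[ℂ] L,
        LinearPMap.mk (R.domainPow 1) (dΓ (ContinuousLinearMap.adjoint B)) ≤
          (LinearPMap.mk (R.domainPow 1) (dΓ B))†) := by
  have := exists_hilbertBasis_nat L hL
  have hdom : ∀ (e : HilbertBasis ℕ ℂ L) (B : L →L[ℂ] L) (M : ℕ),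
      R.domainPow 1 ≤ (R.dGammaPartial e B M).domain := fun e B M x hx =>
    LinearPMap.mem_domain_of_mem_graph (R.exists_mem_graph_dGammaPartial e B M hx).choose_spec.1
  refine ⟨R.dense_domainPow_one, hdom, R.dGamma, fun B e Φ => ?_, R.norm_dGamma_le, fun B => ?_⟩
  · refine R.tendsto_of_hasSum_dGammaPartialSector e B Φ fun M => ?_
    obtain ⟨y, hy, hsum⟩ := R.exists_mem_graph_dGammaPartial e B M Φ.2
    have h := (R.dGammaPartial e B M).mem_graph (Submodule.inclusion (hdom e B M) Φ)
    -- A graph is single-valued, so the value of the partial sum at `Φ` is the `y` with the known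
    -- sector expansion.
    rw [(R.dGammaPartial e B M).mem_graph_snd_inj h hy rfl]
    exact hsum
  · exact LinearPMap.IsFormalAdjoint.le_adjoint
      (T := LinearPMap.mk (R.domainPow 1) (R.dGamma B)) R.dense_domainPow_one
      fun Φ Ψ => R.inner_dGamma B Φ Ψ
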